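/- Let $q\ge 2$ and $n\ge 0$ be integers, let $\beta>0$, and let $\mathsf h\ge 0$ be an integer. Work in the lattice $(\mathbb Z+\frac12)^3$ with nearest-neighbor adjacency, let $$\Lambda_n=\big([-\tfrac n2,\tfrac n2]^2\times[0,n]\big)\cap(\mathbb Z+\tfrac12)^3,\qquad \Lambda_n'=\big([-\tfrac n2,\tfrac n2]^2\times[-n,n]\big)\cap(\mathbb Z+\tfrac12)^3,$$ and for a finite vertex set $\Lambda$ let $\partial\Lambda$ be its outer vertex boundary and $\overline\Lambda=\Lambda\cup\partial\Lambda$, viewed as an induced subgraph of the lattice. The $q$-state Potts model on a finite graph $(V,E)$ is $\mu(\sigma)\propto\exp\big(-\beta\sum_{(u,v)\in E}\mathbf 1_{\{\sigma_u\ne\sigma_v\}}\big)$, $\sigma\in\{1,\dots,q\}^V$; color $1$ is called blue and color $2$ red. Let $\mu_n^{\mathsf{fl}}$ be the Potts model on $\overline{\Lambda_n}$ conditioned on $\partial\Lambda_n$ being blue below height $0$ and red above height $0$, and let $\mu_n^{\mathsf h}$ be the Potts model on $\overline{\Lambda_n'}$ conditioned on $\partial\Lambda_n'$ being blue below height $\mathsf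 h$ and red above height $\mathsf h$. For a coloring $\sigma$ of $\overline\Lambda$ (with $\Lambda=\Lambda_n$ or $\Lambda_n'$ and the respective boundary colors), let $\mathcal V_{\mathsf{blue}}$ be the set of blue vertices joined by a blue path in $\overline\Lambda$ to a blue vertex of $\partial\Lambda$. Let $\widehat{\mathcal V}_{\mathsf{blue}}$ be obtained by adding to it every connected component of $\overline\Lambda\setminus\mathcal V_{\mathsf{blue}}$ whose outer vertex boundary in $(\mathbb Z+\frac12)^3$ is contained in $\mathcal V_{\mathsf{blue}}$. Let $\mathcal I_{\mathsf{blue}}$ be the set of plaquettes (closed unit squares) dual to the edges of $\overline\Lambda$ with one endpoint in $\widehat{\mathcal V}_{\mathsf{blue}}$ and the other in $\overline\Lambda\setminus\widehat{\mathcal V}_{\mathsf{blue}}$. The soft-floor measure is $$\widehat\mu_n^{\mathsf h}=\mu_n^{\mathsf h}\big(\,\cdot\mid \mathcal I_{\mathsf{blue}}\subset\mathbb R^2\times[0,\infty)\big).$$ Let $\mathcal A$ be a family of sets of vertices, and let $A$ be the event $\{\Lambda\setminus\widehat{\mathcal V}_{\mathsf{blue}}\in\mathcal A\}$, read with $\Lambda=\Lambda_n$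 and the boundary conditions of $\mu_n^{\mathsf{fl}}$ in the context of $\mu_n^{\mathsf{fl}}$, and with $\Lambda=\Lambda_n'$ and the boundary conditions of $\mu_n^{\mathsf h}$ in the context of $\widehat\mu_n^{\mathsf h}$. Suppose that in each of the two contexts $A$ is increasing in the set of blue vertices: if a coloring with the prescribed boundary colors is in $A$, then so is every coloring obtained from it by recoloring a vertex of $\Lambda$ blue. Then $$\mu_n^{\mathsf{fl}}(A)\le\widehat\mu_n^{\mathsf h}(A).$$ -/

import Mathlib

open Set MeasureTheory ProbabilityTheory

namespace PottsFloor

/-! ### The Potts model on a finite graph -/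

/-- The number of edges of `G` whose two endpoints receive different colors. -/
noncomputable def disagreements {V : Type*} {q : ℕ} (G : SimpleGraph V) (σ : V → Fin q) : ℕ :=
  {e ∈ G.edgeSet | ¬ (e.map σ).IsDiag}.ncard

/-- The unnormalized Potts measure, giving mass `exp (-β * disagreements)` to each coloring. -/
noncomputable def pottsWeight {V : Type*} [Finite V] (G : SimpleGraph V) (β : ℝ) (q : ℕ) :
    Measure (V → Fin q) :=
  Measure.count.withDensity fun σ => ENNReal.ofReal (Real.exp (-β * disagreements G σ))

/-- The `q`-state Potts model on a finite graph at inverse temperature `β`. -/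
noncomputable def pottsMeasure {V : Type*} [Finite V] (G : SimpleGraph V) (β : ℝ) (q : ℕ) :
    Measure (V → Fin q) :=
  (pottsWeight G β q univ)⁻¹ • pottsWeight G β q

/-- The color blue (the first of the `q` colors). -/
def blue {q : ℕ} (hq : 2 ≤ q) : Fin q := ⟨0, by omega⟩

/-- The color red (the second of the `q` colors). -/
def red {q : ℕ} (hq : 2 ≤ q) : Fin q := ⟨1, by omega⟩

/-! ### The lattice and the boxes -/

/-- The integer vector `v` stands for the point `v + (1/2, 1/2, 1/2)` of the shifted cubic
lattice, that is, for the unit cube whose lowest corner is `v`. -/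
abbrev Site : Type := Fin 3 → ℤ

/-- The coordinates of a site in Euclidean space. -/
noncomputable def pos (v : Site) (i : Fin 3) : ℝ := (v i : ℝ) + 1 / 2

/-- Nearest-neighbor adjacency: the two sites are at `ℓ¹` distance one. -/
def lattice : SimpleGraph Site where
  Adj u v := ∑ i, |u i - v i| = 1
  symm := ⟨fun u v h => by simpa only [abs_sub_comm] using h⟩
  loopless := ⟨fun u h => by simp at h⟩

/-- The sites in `[-n/2, n/2]² × [a, b]`. -/
def box (n : ℕ) (a b : ℤ) : Set Site :=
  {v | pos v 0 ∈ Icc (-(n : ℝ) / 2) ((n : ℝ) / 2) ∧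
       pos v 1 ∈ Icc (-(n : ℝ) / 2) ((n : ℝ) / 2) ∧
       pos v 2 ∈ Icc (a : ℝ) (b : ℝ)}

/-- The box `([-n/2, n/2]² × [0, n]) ∩ (ℤ + 1/2)³`. -/
def floorBox (n : ℕ) : Set Site := box n 0 n

/-- The box `([-n/2, n/2]² × [-n, n]) ∩ (ℤ + 1/2)³`. -/
def fullBox (n : ℕ) : Set Site := box n (-n) n

/-- Outer vertex boundary in the lattice. -/
def outerBoundary (S : Set Site) : Set Site :=
  {v | v ∉ S ∧ ∃ u ∈ S, lattice.Adj v u}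

/-- The region together with its outer vertex boundary. -/
def closedRegion (Λ : Set Site) : Set Site := Λ ∪ outerBoundary Λ

/-- The subgraph of the lattice induced on the region together with its outer vertex boundary. -/
def regionGraph (Λ : Set Site) : SimpleGraph (closedRegion Λ) := lattice.induce (closedRegion Λ)

instance box_finite (n : ℕ) (a b : ℤ) : Finite (box n a b) := by
  refine Set.Finite.to_subtype ((Set.finite_Icc (fun i => if i = 2 then a - 1 else -(n : ℤ) - 1)
    (fun i => if i = 2 then b else (n : ℤ)) : Set.Finite (_ : Set Site)).subset ?_)
  rintro v ⟨⟨h0, h0'⟩, ⟨h1, h1'⟩, ⟨h2, h2'⟩⟩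
  have hn : (0 : ℝ) ≤ n := Nat.cast_nonneg n
  simp only [pos] at h0 h0' h1 h1' h2 h2'
  constructor <;> intro i <;> fin_cases i <;> simp <;> rw [← Int.cast_le (R := ℝ)] <;>
    push_cast <;> linarith

instance floorBox_finite (n : ℕ) : Finite (floorBox n) := box_finite n 0 n

instance fullBox_finite (n : ℕ) : Finite (fullBox n) := box_finite n (-n) n

instance closedRegion_finite (Λ : Set Site) [Finite Λ] : Finite (closedRegion Λ) := by
  have hΛ : Λ.Finite := Set.toFinite Λ
  refine Set.Finite.to_subtype (hΛ.union ((hΛ.biUnion (t := fun u : Site =>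
    Set.Icc (fun i => u i - 1) (fun i => u i + 1)) fun u _ => Set.finite_Icc _ _).subset ?_))
  rintro v ⟨-, u, hu, huv⟩
  simp only [mem_iUnion]
  refine ⟨u, hu, ?_⟩
  have key : ∀ i, |v i - u i| ≤ 1 := fun i =>
    (Finset.single_le_sum (f := fun i => |v i - u i|) (fun j _ => abs_nonneg _)
      (Finset.mem_univ i)).trans (le_of_eq huv)
  constructor <;> intro i <;> have := abs_le.1 (key i) <;> simp only <;> linarith [this.1, this.2]

/-! ### Boundary conditions flipping from blue to red at a given height -/

/-- Color blue below height `h`, red above height `h`. -/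
noncomputable def flipColor {q : ℕ} (hq : 2 ≤ q) (h : ℤ) (v : Site) : Fin q :=
  open Classical in if pos v 2 < (h : ℝ) then blue hq else red hq

/-- The colorings of the closed region whose boundary values are blue below height `h` and red
above height `h`. -/
def admissible {q : ℕ} (hq : 2 ≤ q) (Λ : Set Site) (h : ℤ) : Set (closedRegion Λ → Fin q) :=
  {σ | ∀ v : closedRegion Λ, (v : Site) ∈ outerBoundary Λ → σ v = flipColor hq h v}

/-- The Potts model on `Λ` with boundary values blue below height `h` and red above. -/
noncomputable def flipMeasure {q : ℕ} (hq : 2 ≤ q) (β : ℝ) (Λ : Set Site) [Finite Λ] (h : ℤ) :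
    Measure (closedRegion Λ → Fin q) :=
  (pottsMeasure (regionGraph Λ) β q)[|admissible hq Λ h]

/-! ### The blue phase and the blue interface -/

/-- The connected component of `v` in the subgraph of the lattice induced on `S`
(empty if `v ∉ S`). -/
def component (S : Set Site) (v : Site) : Set Site :=
  {w | ∃ (hv : v ∈ S) (hw : w ∈ S), (lattice.induce S).Reachable ⟨v, hv⟩ ⟨w, hw⟩}

/-- All the sites colored blue, boundary sites included. -/
def blueSites {q : ℕ} (hq : 2 ≤ q) {Λ : Set Site} (σ : closedRegion Λ → Fin q) : Set Site :=
  {v | ∃ hv : v ∈ closedRegion Λ, σ ⟨v, hv⟩ = blue hq}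

/-- The blue sites connected by a blue path to the blue boundary sites. -/
def blueCluster {q : ℕ} (hq : 2 ≤ q) {Λ : Set Site} (σ : closedRegion Λ → Fin q) : Set Site :=
  {w | ∃ b ∈ outerBoundary Λ, w ∈ component (blueSites hq σ) b}

/-- The augmented blue set: the blue cluster of the boundary together with its bubbles, the
connected components of the rest of the closed region all of whose outer neighbors in the lattice
belong to the blue cluster. A component that meets the boundary of the region has neighbors
outside the closed region, so it is not a bubble. -/
def augBlue {q : ℕ} (hq : 2 ≤ q) {Λ : Set Site} (σ : closedRegion Λ → Fin q) : Set Site :=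
  blueCluster hq σ ∪
    {v | v ∈ closedRegion Λ \ blueCluster hq σ ∧
      outerBoundary (component (closedRegion Λ \ blueCluster hq σ) v) ⊆ blueCluster hq σ}

/-- The closed unit cube centered at a site. -/
def cube (v : Site) : Set (Fin 3 → ℝ) := {p | ∀ i, p i ∈ Icc (v i : ℝ) ((v i : ℝ) + 1)}

/-- The blue interface: the plaquettes dual to the edges between the augmented blue set and its
complement, the plaquette dual to an edge being the common face of the two unit cubes. -/
def blueInterface {q : ℕ} (hq : 2 ≤ q) {Λ : Set Site} (σ : closedRegion Λ → Fin q) :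
    Set (Set (Fin 3 → ℝ)) :=
  {f | ∃ x ∈ augBlue hq σ, ∃ y ∈ closedRegion Λ \ augBlue hq σ,
    lattice.Adj x y ∧ f = cube x ∩ cube y}

/-- The event that the blue interface lies in the half-space of nonnegative heights. -/
def softFloorEvent {q : ℕ} (hq : 2 ≤ q) (Λ : Set Site) : Set (closedRegion Λ → Fin q) :=
  {σ | ⋃₀ blueInterface hq σ ⊆ {p | 0 ≤ p 2}}

/-! ### The two measures -/

/-- The hard-floor measure: box of heights `[0, n]`, blue below height `0` and red elsewhere. -/
noncomputable def hardFloorMeasure {q : ℕ} (hq : 2 ≤ q) (β : ℝ) (n : ℕ) :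
    Measure (closedRegion (floorBox n) → Fin q) :=
  flipMeasure hq β (floorBox n) 0

/-- The soft-floor measure: box of heights `[-n, n]`, boundary flipping at height `h`,
conditioned on the blue interface having nonnegative height. -/
noncomputable def softFloorMeasure {q : ℕ} (hq : 2 ≤ q) (β : ℝ) (n : ℕ) (h : ℤ) :
    Measure (closedRegion (fullBox n) → Fin q) :=
  (flipMeasure hq β (fullBox n) h)[|softFloorEvent hq (fullBox n)]

/-! ### Events -/

/-- The event, determined by the complement of the augmented blue set, that this complement
(as a set of sites of `Λ`) belongs to the family `𝒜`. -/
def complEvent {q : ℕ} (hq : 2 ≤ q) (Λ : Set Site) (𝒜 : Set (Set Site)) :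
    Set (closedRegion Λ → Fin q) :=
  {σ | Λ \ augBlue hq σ ∈ 𝒜}

open Classical in
/-- With boundary values flipping at height `h`, the event `A` is closed under the operation of
coloring any site of `Λ` in blue. -/
def IncreasingInBlue {q : ℕ} (hq : 2 ≤ q) (Λ : Set Site) (h : ℤ)
    (A : Set (closedRegion Λ → Fin q)) : Prop :=
  ∀ σ ∈ admissible hq Λ h, σ ∈ A →
    ∀ v : closedRegion Λ, (v : Site) ∈ Λ → Function.update σ v (blue hq) ∈ A

end PottsFloor

/-! The proof is a Holley-type comparison of sets of non-blue vertices, made separately on each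
class of a partition of the soft-floor colorings.

Log-supermodularity. Let the vertices of a set `T` be blue or red only. The total weight of the
colorings with non-blue set `X` is then log-supermodular in `X` (`fuzzyWeight_mul_le`). Put the
non-blue colors in bijection with a finite abelian group, red being zero, and expand the agreement
weights inside `X` over edge sets `ω`. The labelings compatible with `ω` form a subgroup, whose
cardinality is log-supermodular in `ω` by the second isomorphism theorem, and the four functions
theorem sums this over `ω`. Since `T` permits both blue and red, one function describes boundary
values flipping at height `0` and at height `h`.

Revealing pockets. The soft-floor condition says that the complement of the augmented blue set stays
at nonnegative heights (`mem_softFloorEvent_iff`). Fix the colors outside `freeSites`, that is, on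
and next to the components reaching below the floor as well as outside the floor box. The free sites
then see only blue or prescribed boundary colors, so up to a constant their weight is that of a
coloring of the floor box with boundary flipping at `h` (`gibbsWeight_transplant`). The remaining
constraint on the class is preserved when free sites turn blue (`freeSites_eq_of_recolor`).

Holley comparison. Let `X` be the non-blue set of a hard-floor coloring in the event and `Y` that of
a transplanted soft-floor coloring. The set `X ∪ Y` has the hard-floor boundary values, and the
colorings of the soft class with non-blue set `X ∩ Y` lie in the event (`mem_complEvent_of_hard`).
The four functions theorem gives the inequality on each class (`softClass_comparison`), and summing
over the classes gives the result.

The event is transferred between boxes through `upperPhase`, a set that is the red part of a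
recolored hard-floor coloring and of a two-color coloring of the full box. -/

namespace PottsFloor

/-! ### Log-supermodularity of the law of the set of non-blue vertices -/

section Counting

variable {V Z : Type*} [AddCommGroup Z]

/-- The labelings vanishing on `T` that are constant along every edge of `ω`. -/
def constantLabelings (Z : Type*) [AddCommGroup Z] (T : Set V) (ω : Set (Sym2 V)) :
    AddSubgroup (V → Z) where
  carrier := {z | (∀ v ∈ T, z v = 0) ∧ ∀ a b, s(a, b) ∈ ω → z a = z b}
  zero_mem' := by simp
  add_mem' := by
    rintro x y ⟨hx, hx'⟩ ⟨hy, hy'⟩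
    exact ⟨fun v hv => by simp [hx v hv, hy v hv],
      fun a b h => by simp [hx' a b h, hy' a b h]⟩
  neg_mem' := by
    rintro x ⟨hx, hx'⟩
    exact ⟨fun v hv => by simp [hx v hv], fun a b h => by simp [hx' a b h]⟩

/-- Second isomorphism theorem: `H ⊓ K` has the same index in `K` as `H` has in `H ⊔ K`. -/
theorem card_mul_card_eq_card_inf_mul_card_sup {G : Type*} [AddCommGroup G]
    (H K : AddSubgroup G) :
    Nat.card H * Nat.card K =
      Nat.card (H ⊓ K : AddSubgroup G) * Nat.card (H ⊔ K : AddSubgroup G) := by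
  have h1 := AddSubgroup.relIndex_mul_relIndex (⊥ : AddSubgroup G) (H ⊓ K) K bot_le inf_le_right
  have h2 := AddSubgroup.relIndex_mul_relIndex (⊥ : AddSubgroup G) H (H ⊔ K) bot_le le_sup_left
  rw [AddSubgroup.relIndex_bot_left, AddSubgroup.relIndex_bot_left,
    AddSubgroup.inf_relIndex_right] at h1
  rw [AddSubgroup.relIndex_bot_left, AddSubgroup.relIndex_bot_left,
    AddSubgroup.relIndex_sup_left] at h2
  rw [← h1, ← h2]; ring

/-- A labeling constant along both `ω` and `ω'` is constant along `ω ∪ ω'`, and a sum of one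
labeling of each kind is constant along `ω ∩ ω'`. These two inclusions of subgroups suffice, with no
need to count clusters. -/
theorem card_constantLabelings_mul_le [Finite V] [Finite Z] (T : Set V) (ω ω' : Set (Sym2 V)) :
    Nat.card (constantLabelings Z T ω) * Nat.card (constantLabelings Z T ω') ≤
      Nat.card (constantLabelings Z T (ω ∩ ω')) * Nat.card (constantLabelings Z T (ω ∪ ω')) := by
  rw [card_mul_card_eq_card_inf_mul_card_sup, mul_comm]
  refine Nat.mul_le_mul (Nat.card_le_card_of_injective _ (AddSubgroup.inclusion_injective
    (?_ : _ ≤ constantLabelings Z T (ω ∩ ω')))) (Nat.card_le_card_of_injective _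
      (AddSubgroup.inclusion_injective ?_))
  · exact sup_le (fun z hz => ⟨hz.1, fun a b h => hz.2 a b h.1⟩)
      fun z hz => ⟨hz.1, fun a b h => hz.2 a b h.2⟩
  · rintro z ⟨hz, hz'⟩
    exact ⟨hz.1, fun a b h => h.elim (hz.2 a b) (hz'.2 a b)⟩

end Counting

/-! ### Random-cluster expansion of the weight of a non-blue set -/

section Weights

open Classical

variable {V : Type*} [Fintype V]

/-- Rewarding agreements instead of penalizing disagreements makes every edge factor at least `1`
when `β ≥ 0`, ready for expansion. -/
theorem exp_neg_disagreements {q : ℕ} (G : SimpleGraph V) (β : ℝ) (σ : V → Fin q) :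
    Real.exp (-β * disagreements G σ) = Real.exp (-β) ^ G.edgeFinset.card *
      ∏ e ∈ G.edgeFinset, if (e.map σ).IsDiag then Real.exp β else 1 := by
  have h1 : disagreements G σ = (G.edgeFinset.filter fun e => ¬ (e.map σ).IsDiag).card := by
    rw [disagreements, ← Set.ncard_coe_finset]
    congr 1; ext e; simp
  have h2 := Finset.card_filter_add_card_filter_not (s := G.edgeFinset)
    (fun e => (e.map σ).IsDiag)
  rw [Finset.prod_ite, Finset.prod_const, Finset.prod_const_one, mul_one, h1, ← h2, pow_add,
    mul_right_comm, ← mul_pow, ← Real.exp_add, neg_add_cancel, Real.exp_zero, one_pow, one_mul,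
    ← Real.exp_nat_mul, mul_comm]

/-- The total weight of the colorings whose set of non-blue vertices is `X` and which are red
on `X ∩ T`. -/
noncomputable def fuzzyWeight {q : ℕ} (hq : 2 ≤ q) (G : SimpleGraph V) (β : ℝ) (T X : Set V) : ℝ :=
  ∑ σ : V → Fin q with {v | σ v ≠ blue hq} = X ∧ ∀ v ∈ X ∩ T, σ v = red hq,
    Real.exp (-β * disagreements G σ)

/-- The coloring that is blue off `X` and is read off the labels `z` on `X`. -/
noncomputable def paint {m : ℕ} (X : Set V) (z : V → Fin (m + 1)) (v : V) : Fin (m + 2) :=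
  if v ∈ X then (z v).succ else 0

/-- The number of labelings vanishing on `T` which give the same `paint X`. -/
noncomputable def paintMult (m : ℕ) (T X : Set V) : ℝ :=
  ∏ v : V, if v ∈ X ∪ T then 1 else ((m : ℝ) + 1)

theorem paintMult_pos (m : ℕ) (T X : Set V) : 0 < paintMult m T X :=
  Finset.prod_pos fun v _ => by split_ifs <;> positivity

theorem paintMult_mul (m : ℕ) (T X Y : Set V) :
    paintMult m T X * paintMult m T Y = paintMult m T (X ∩ Y) * paintMult m T (X ∪ Y) := by
  simp only [paintMult, ← Finset.prod_mul_distrib]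
  refine Finset.prod_congr rfl fun v _ => ?_
  by_cases h1 : v ∈ X <;> by_cases h2 : v ∈ Y <;> by_cases h3 : v ∈ T <;> simp [h1, h2, h3]

/-- Labels off `X` are invisible in the painted coloring: each is free unless its vertex lies in
`T`. Hence all fibers of `paint X` have size `paintMult`. Label zero paints red, which matches the
constraint on `X ∩ T`. -/
theorem sum_paint {m : ℕ} (hq : 2 ≤ m + 2) (G : SimpleGraph V) (β : ℝ) (T X : Set V) :
    ∑ z : V → Fin (m + 1) with ∀ v ∈ T, z v = 0,
      Real.exp (-β * disagreements G (paint X z)) =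
    paintMult m T X * fuzzyWeight hq G β T X := by
  have hb : blue hq = (0 : Fin (m + 2)) := rfl
  have hr : red hq = (0 : Fin (m + 1)).succ := rfl
  rw [Finset.sum_comp (fun σ => Real.exp (-β * disagreements G σ)) (paint X), fuzzyWeight,
    Finset.mul_sum]
  refine Finset.sum_congr ?_ fun σ hσ => ?_
  · ext σ
    simp only [Finset.mem_image, Finset.mem_filter, Finset.mem_univ, true_and, hb, hr]
    constructor
    · rintro ⟨z, hz, rfl⟩
      refine ⟨?_, fun v hv => by simp [paint, hv.1, hz v hv.2]⟩
      ext v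
      by_cases hv : v ∈ X <;> simp [paint, hv, Fin.succ_ne_zero]
    · rintro ⟨rfl, hT⟩
      refine ⟨fun v => if h : σ v = 0 then 0 else (σ v).pred h, fun v hv => ?_, ?_⟩
      · by_cases h : σ v = 0
        · simp [h]
        · have := hT v ⟨h, hv⟩
          simp only [this, Fin.pred_succ]
          simp
      · ext v
        by_cases h : σ v = 0 <;> simp [paint, h]
  · simp only [Finset.mem_filter, Finset.mem_univ, true_and, hb, hr] at hσ
    rw [nsmul_eq_mul]
    congr 1
    obtain ⟨rfl, hT⟩ := hσ
    -- The fiber is a product set: the label is determined at non-blue vertices, zero at blue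
    -- vertices of `T`, and arbitrary at other blue vertices.
    have : (Finset.univ.filter fun z : V → Fin (m + 1) => ∀ v ∈ T, z v = 0).filter
        (fun z => paint {v | σ v ≠ 0} z = σ) =
        Fintype.piFinset fun v => if h : σ v = 0 then (if v ∈ T then {0} else Finset.univ) else
          {(σ v).pred h} := by
      ext z
      simp only [Finset.mem_filter, Finset.mem_univ, true_and, Fintype.mem_piFinset]
      constructor
      · rintro ⟨hz, hz'⟩ v
        have := congrFun hz' v
        by_cases h : σ v = 0
        · by_cases h' : v ∈ T <;> simp [h, h', hz v]
        · simp only [paint, mem_ofPred_eq, ne_eq, h, not_false_eq_true, if_true] at this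
          simp [← this]
      · intro hz
        refine ⟨fun v hv => ?_, ?_⟩
        · have := hz v
          by_cases h : σ v = 0
          · simpa [h, hv] using this
          · simp only [h, dite_false, Finset.mem_singleton] at this
            simp only [this, hT v ⟨h, hv⟩, Fin.pred_succ]
        · ext v
          have := hz v
          by_cases h : σ v = 0
          · simp [paint, h]
          · simp only [h, dite_false, Finset.mem_singleton] at this
            simp [paint, h, this]
    rw [this, Fintype.card_piFinset, paintMult, Nat.cast_prod]
    refine Finset.prod_congr rfl fun v _ => ?_
    by_cases h : σ v = 0 <;> by_cases h' : v ∈ T <;> simp [h, h']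

/-- The contribution of the edges between blue vertices. -/
noncomputable def blueEdgeWeight (G : SimpleGraph V) (β : ℝ) (X : Set V) : ℝ :=
  ∏ e ∈ G.edgeFinset, if ∀ v ∈ e, v ∉ X then Real.exp β else 1

theorem blueEdgeWeight_pos (G : SimpleGraph V) (β : ℝ) (X : Set V) : 0 < blueEdgeWeight G β X :=
  Finset.prod_pos fun e _ => by split_ifs <;> positivity

/-- The inequality holds edge by edge. An edge avoiding both sets contributes equally to both sides,
as does one avoiding exactly one of them; for an edge avoiding neither, the left factor is `1`. -/
theorem blueEdgeWeight_mul_le (G : SimpleGraph V) {β : ℝ} (hβ : 0 ≤ β) (X Y : Set V) :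
    blueEdgeWeight G β X * blueEdgeWeight G β Y ≤
      blueEdgeWeight G β (X ∩ Y) * blueEdgeWeight G β (X ∪ Y) := by
  have h1 : 1 ≤ Real.exp β := Real.one_le_exp hβ
  simp only [blueEdgeWeight, ← Finset.prod_mul_distrib]
  refine Finset.prod_le_prod (fun e _ => by positivity) fun e _ => ?_
  by_cases hX : ∀ v ∈ e, v ∉ X <;> by_cases hY : ∀ v ∈ e, v ∉ Y
  · rw [if_pos hX, if_pos hY, if_pos fun v hv h => hX v hv h.1,
      if_pos fun v hv h => h.elim (hX v hv) (hY v hv)]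
  · rw [if_pos hX, if_neg hY, if_pos fun v hv h => hX v hv h.1,
      if_neg fun h => hY fun v hv h' => h v hv (Or.inr h')]
  · rw [if_neg hX, if_pos hY, if_pos fun v hv h => hY v hv h.2,
      if_neg fun h => hX fun v hv h' => h v hv (Or.inl h'), mul_comm]
  · rw [if_neg hX, if_neg hY, one_mul]
    refine one_le_mul_of_one_le_of_one_le ?_ ?_ <;> split_ifs <;> simp [h1]

/-- The random-cluster weight of the edge set `ω` inside `X`. -/
noncomputable def clusterWeight (m : ℕ) (G : SimpleGraph V) (β : ℝ) (T X : Set V)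
    (ω : Finset (Sym2 V)) : ℝ :=
  if (∀ e ∈ ω, e ∈ G.edgeFinset ∧ ∀ v ∈ e, v ∈ X) then
    (Real.exp β - 1) ^ ω.card * Nat.card (constantLabelings (Fin (m + 1)) T (ω : Set (Sym2 V)))
  else 0

theorem clusterWeight_nonneg (m : ℕ) (G : SimpleGraph V) {β : ℝ} (hβ : 0 ≤ β) (T X : Set V) :
    0 ≤ clusterWeight m G β T X := fun ω => by
  have : 0 ≤ Real.exp β - 1 := sub_nonneg.2 (Real.one_le_exp hβ)
  simp only [clusterWeight, Pi.zero_apply]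
  split_ifs <;> positivity

/-- The powers of `exp β - 1` balance exactly because cardinality is modular, so only the count of
labelings contributes an inequality. -/
theorem clusterWeight_mul_le (m : ℕ) (G : SimpleGraph V) {β : ℝ} (hβ : 0 ≤ β) (T X Y : Set V)
    (ω ω' : Finset (Sym2 V)) :
    clusterWeight m G β T X ω * clusterWeight m G β T Y ω' ≤
      clusterWeight m G β T (X ∩ Y) (ω ⊓ ω') * clusterWeight m G β T (X ∪ Y) (ω ⊔ ω') := by
  have hp : 0 ≤ Real.exp β - 1 := sub_nonneg.2 (Real.one_le_exp hβ)
  have hnn := mul_nonneg (clusterWeight_nonneg m G hβ T (X ∩ Y) (ω ⊓ ω'))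
    (clusterWeight_nonneg m G hβ T (X ∪ Y) (ω ⊔ ω'))
  by_cases h : ∀ e ∈ ω, e ∈ G.edgeFinset ∧ ∀ v ∈ e, v ∈ X
  swap
  · rw [clusterWeight, if_neg h, zero_mul]; exact hnn
  by_cases h' : ∀ e ∈ ω', e ∈ G.edgeFinset ∧ ∀ v ∈ e, v ∈ Y
  swap
  · rw [clusterWeight.eq_1 m G β T Y, if_neg h', mul_zero]; exact hnn
  have h1 : ∀ e ∈ ω ⊓ ω', e ∈ G.edgeFinset ∧ ∀ v ∈ e, v ∈ X ∩ Y := fun e he => by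
    rw [Finset.inf_eq_inter, Finset.mem_inter] at he
    exact ⟨(h e he.1).1, fun v hv => ⟨(h e he.1).2 v hv, (h' e he.2).2 v hv⟩⟩
  have h2 : ∀ e ∈ ω ⊔ ω', e ∈ G.edgeFinset ∧ ∀ v ∈ e, v ∈ X ∪ Y := fun e he => by
    rw [Finset.sup_eq_union, Finset.mem_union] at he
    rcases he with he | he
    · exact ⟨(h e he).1, fun v hv => Or.inl ((h e he).2 v hv)⟩
    · exact ⟨(h' e he).1, fun v hv => Or.inr ((h' e he).2 v hv)⟩
  simp only [clusterWeight]
  rw [if_pos h, if_pos h', if_pos h1, if_pos h2, mul_mul_mul_comm,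
    mul_mul_mul_comm (_ ^ (ω ⊓ ω').card), ← pow_add, ← pow_add,
    Finset.inf_eq_inter, Finset.sup_eq_union, Finset.card_inter_add_card_union]
  refine mul_le_mul_of_nonneg_left ?_ (by positivity)
  exact_mod_cast card_constantLabelings_mul_le (Z := Fin (m + 1)) T (ω : Set (Sym2 V)) ω'

/-- Edges with both ends off `X` agree, edges with one end in `X` disagree, and each edge inside `X`
has factor `1 + (exp β - 1)` or `1`. Expanding the product of these last factors and exchanging sums
leaves, for each `ω`, the number of labelings constant along `ω`. -/
theorem sum_exp_paint {m : ℕ} (G : SimpleGraph V) (β : ℝ) (T X : Set V) :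
    ∑ z : V → Fin (m + 1) with ∀ v ∈ T, z v = 0,
      Real.exp (-β * disagreements G (paint X z)) =
    Real.exp (-β) ^ G.edgeFinset.card * (blueEdgeWeight G β X *
      ∑ ω, clusterWeight m G β T X ω) := by
  have key : ∀ z : V → Fin (m + 1), Real.exp (-β * disagreements G (paint X z)) =
      Real.exp (-β) ^ G.edgeFinset.card * (blueEdgeWeight G β X *
        ∏ e ∈ G.edgeFinset.filter (fun e => ∀ v ∈ e, v ∈ X),
          (1 + (if (e.map z).IsDiag then Real.exp β - 1 else 0))) := by
    intro z
    rw [exp_neg_disagreements, blueEdgeWeight, Finset.prod_filter, ← Finset.prod_mul_distrib]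
    congr 1
    refine Finset.prod_congr rfl fun e _ => ?_
    induction e with | _ a b
    by_cases ha : a ∈ X <;> by_cases hb : b ∈ X <;>
      simp [paint, ha, hb, Fin.succ_ne_zero, (Fin.succ_ne_zero _).symm]
    split_ifs <;> simp
  simp only [key, ← Finset.mul_sum]
  congr 2
  simp only [Finset.prod_one_add]
  rw [Finset.sum_comm, ← Finset.sum_subset (Finset.subset_univ
    (G.edgeFinset.filter (fun e => ∀ v ∈ e, v ∈ X)).powerset)]
  · refine Finset.sum_congr rfl fun ω hω => ?_
    rw [Finset.mem_powerset] at hω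
    rw [clusterWeight, if_pos fun e he => by simpa using hω he]
    have : ∀ z : V → Fin (m + 1), (∏ e ∈ ω, if (e.map z).IsDiag then Real.exp β - 1 else 0) =
        if ∀ e ∈ ω, (e.map z).IsDiag then (Real.exp β - 1) ^ ω.card else 0 := by
      intro z
      split_ifs with h
      · rw [Finset.prod_congr rfl fun e he => if_pos (h e he), Finset.prod_const]
      · push Not at h
        obtain ⟨e, he, h⟩ := h
        exact Finset.prod_eq_zero he (if_neg h)
    simp only [this]
    rw [← Finset.sum_filter, Finset.sum_const, nsmul_eq_mul, mul_comm, Finset.filter_filter]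
    congr 2
    refine (Nat.subtype_card _ fun z => ?_).symm
    simp only [Finset.mem_filter, Finset.mem_univ, true_and]
    refine and_congr_right fun _ => ⟨fun h a b hab => ?_, fun h e he => ?_⟩
    · simpa using h _ hab
    · induction e with | _ a b
      simpa using h a b he
  · intro ω _ hω
    rw [clusterWeight, if_neg]
    intro h
    exact hω (Finset.mem_powerset.2 fun e he => by simpa using h e he)

/-- The law of the set of non-blue vertices in a ferromagnetic Potts model, with the vertices of
`T` allowed to be only blue or red, is log-supermodular. -/
theorem fuzzyWeight_mul_le {q : ℕ} (hq : 2 ≤ q) (G : SimpleGraph V) {β : ℝ} (hβ : 0 ≤ β)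
    (T X Y : Set V) :
    fuzzyWeight hq G β T X * fuzzyWeight hq G β T Y ≤
      fuzzyWeight hq G β T (X ∩ Y) * fuzzyWeight hq G β T (X ∪ Y) := by
  obtain ⟨m, rfl⟩ : ∃ m, q = m + 2 := ⟨q - 2, by omega⟩
  have hfuzzy : ∀ X, paintMult m T X * fuzzyWeight hq G β T X = _ := fun X =>
    (sum_paint hq G β T X).symm.trans (sum_exp_paint G β T X)
  -- Here the lattice is that of edge sets, with `X` and `Y` fixed.
  have four := four_functions_theorem_univ (clusterWeight m G β T X) (clusterWeight m G β T Y)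
    (clusterWeight m G β T (X ∩ Y)) (clusterWeight m G β T (X ∪ Y))
    (clusterWeight_nonneg m G hβ T _) (clusterWeight_nonneg m G hβ T _)
    (clusterWeight_nonneg m G hβ T _) (clusterWeight_nonneg m G hβ T _)
    (clusterWeight_mul_le m G hβ T X Y)
  have hpos := mul_pos (paintMult_pos m T X) (paintMult_pos m T Y)
  refine le_of_mul_le_mul_left ?_ hpos
  calc _ = (paintMult m T X * fuzzyWeight hq G β T X) *
        (paintMult m T Y * fuzzyWeight hq G β T Y) := by ring
    _ ≤ (paintMult m T (X ∩ Y) * fuzzyWeight hq G β T (X ∩ Y)) *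
        (paintMult m T (X ∪ Y) * fuzzyWeight hq G β T (X ∪ Y)) := by
      simp only [hfuzzy]
      rw [mul_mul_mul_comm, mul_mul_mul_comm _ (blueEdgeWeight G β (X ∩ Y) * _)]
      refine mul_le_mul_of_nonneg_left ?_ (by positivity)
      rw [mul_mul_mul_comm, mul_mul_mul_comm (blueEdgeWeight G β (X ∩ Y))]
      exact mul_le_mul (blueEdgeWeight_mul_le G hβ X Y) four
        (mul_nonneg (Finset.sum_nonneg fun ω _ => clusterWeight_nonneg m G hβ T _ ω)
          (Finset.sum_nonneg fun ω _ => clusterWeight_nonneg m G hβ T _ ω))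
        (mul_nonneg (blueEdgeWeight_pos G β _).le (blueEdgeWeight_pos G β _).le)
    _ = _ := by rw [paintMult_mul]; ring

end Weights

/-! ### Lattice geometry -/

theorem lattice_adj_iff {u v : Site} : lattice.Adj u v ↔
    (u 0 = v 0 ∧ u 1 = v 1 ∧ (u 2 = v 2 + 1 ∨ v 2 = u 2 + 1)) ∨
    (u 0 = v 0 ∧ u 2 = v 2 ∧ (u 1 = v 1 + 1 ∨ v 1 = u 1 + 1)) ∨
    (u 1 = v 1 ∧ u 2 = v 2 ∧ (u 0 = v 0 + 1 ∨ v 0 = u 0 + 1)) := by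
  change ∑ i, |u i - v i| = 1 ↔ _
  rw [Fin.sum_univ_three]
  rcases abs_cases (u 0 - v 0) with h0 | h0 <;> rcases abs_cases (u 1 - v 1) with h1 | h1 <;>
    rcases abs_cases (u 2 - v 2) with h2 | h2 <;> omega

theorem mem_box_iff {n : ℕ} {a b : ℤ} {v : Site} : v ∈ box n a b ↔
    (-(n : ℤ) ≤ 2 * v 0 + 1 ∧ 2 * v 0 + 1 ≤ n) ∧ (-(n : ℤ) ≤ 2 * v 1 + 1 ∧ 2 * v 1 + 1 ≤ n) ∧
      a ≤ v 2 ∧ v 2 + 1 ≤ b := by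
  have half : ∀ x : ℤ, ((x : ℝ) + 1 / 2 ∈ Icc (-(n : ℝ) / 2) ((n : ℝ) / 2)) ↔
      (-(n : ℤ) ≤ 2 * x + 1 ∧ 2 * x + 1 ≤ n) := by
    intro x
    rw [← @Int.cast_le ℝ, ← @Int.cast_le ℝ, mem_Icc]
    push_cast
    constructor <;> rintro ⟨h1, h2⟩ <;> constructor <;> linarith
  have whole : ∀ x : ℤ, ((x : ℝ) + 1 / 2 ∈ Icc (a : ℝ) b) ↔ a ≤ x ∧ x + 1 ≤ b := by
    intro x
    have e1 : (a : ℝ) ≤ x + 1 / 2 ↔ a ≤ x := by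
      constructor
      · intro h
        by_contra! h'
        have : (x : ℝ) + 1 ≤ a := by exact_mod_cast h'
        linarith
      · intro h
        have : (a : ℝ) ≤ x := by exact_mod_cast h
        linarith
    have e2 : (x : ℝ) + 1 / 2 ≤ b ↔ x + 1 ≤ b := by
      constructor
      · intro h
        by_contra! h'
        have : (b : ℝ) ≤ x := by exact_mod_cast (by omega : b ≤ x)
        linarith
      · intro h
        have : (x : ℝ) + 1 ≤ b := by exact_mod_cast h
        linarith
    rw [mem_Icc, e1, e2]
  simp only [box, pos]
  exact and_congr (half _) (and_congr (half _) (whole _))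

theorem mem_floorBox_iff {n : ℕ} {v : Site} : v ∈ floorBox n ↔ v ∈ fullBox n ∧ 0 ≤ v 2 := by
  rw [floorBox, fullBox, mem_box_iff, mem_box_iff]
  omega

theorem mem_outerBoundary_of_adj {Λ : Set Site} {u v : Site} (hu : u ∈ Λ) (hv : v ∉ Λ)
    (h : lattice.Adj u v) : v ∈ outerBoundary Λ := ⟨hv, u, hu, h.symm⟩

theorem mem_closedRegion_of_adj {Λ : Set Site} {u v : Site} (hu : u ∈ Λ)
    (h : lattice.Adj u v) : v ∈ closedRegion Λ := by
  by_cases hv : v ∈ Λ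
  · exact Or.inl hv
  · exact Or.inr (mem_outerBoundary_of_adj hu hv h)

theorem mem_outerBoundary_floorBox_iff {n : ℕ} {v : Site} (hv : 0 ≤ v 2) :
    v ∈ outerBoundary (floorBox n) ↔ v ∈ outerBoundary (fullBox n) := by
  constructor
  · rintro ⟨h, u, hu, huv⟩
    rw [mem_floorBox_iff] at h hu
    exact ⟨fun h' => h ⟨h', hv⟩, u, hu.1, huv⟩
  · rintro ⟨h, u, hu, huv⟩
    refine ⟨fun h' => h (mem_floorBox_iff.1 h').1, u, ?_, huv⟩
    rw [lattice_adj_iff] at huv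
    simp only [floorBox, fullBox, mem_box_iff] at *
    omega

theorem mem_fullBox_of_mem_outerBoundary_floorBox {n : ℕ} {v : Site}
    (h : v ∈ outerBoundary (floorBox n)) (hv : v 2 < 0) : v ∈ fullBox n := by
  obtain ⟨h, u, hu, huv⟩ := h
  rw [lattice_adj_iff] at huv
  simp only [floorBox, fullBox, mem_box_iff] at *
  omega

theorem closedRegion_floorBox_subset {n : ℕ} :
    closedRegion (floorBox n) ⊆ closedRegion (fullBox n) := by
  rintro v (h | h)
  · exact Or.inl (mem_floorBox_iff.1 h).1
  · rcases lt_or_ge (v 2) 0 with hv | hv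
    · exact Or.inl (mem_fullBox_of_mem_outerBoundary_floorBox h hv)
    · exact Or.inr ((mem_outerBoundary_floorBox_iff hv).1 h)

theorem mem_closedRegion_floorBox {n : ℕ} {v : Site} (hv : 0 ≤ v 2)
    (h : v ∈ closedRegion (fullBox n)) : v ∈ closedRegion (floorBox n) := by
  rcases h with h | h
  · exact Or.inl (mem_floorBox_iff.2 ⟨h, hv⟩)
  · exact Or.inr ((mem_outerBoundary_floorBox_iff hv).2 h)

/-- Every boundary site has a neighbor outside the closed region. -/
def BoundaryExits (Λ : Set Site) : Prop :=
  ∀ v ∈ outerBoundary Λ, ∃ x, x ∉ closedRegion Λ ∧ lattice.Adj x v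

theorem boundaryExits_box (n : ℕ) (a b : ℤ) : BoundaryExits (box n a b) := by
  rintro v ⟨hv, u, hu, huv⟩
  -- The reflection of the inner neighbor `u` through `v`: one further step outward, at distance two
  -- from the box.
  refine ⟨fun i => 2 * v i - u i, ?_, ?_⟩
  · rintro (h | ⟨h, u', hu', huv'⟩)
    · rw [lattice_adj_iff] at huv
      simp only [mem_box_iff] at *
      omega
    · rw [lattice_adj_iff] at huv huv'
      simp only [mem_box_iff] at *
      omega
  · rw [lattice_adj_iff] at huv ⊢
    omega

/-- The site just below. -/
def below (v : Site) : Site := ![v 0, v 1, v 2 - 1]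

theorem adj_below (v : Site) : lattice.Adj v (below v) := by
  rw [lattice_adj_iff]; simp [below]

theorem below_apply_two (v : Site) : below v 2 = v 2 - 1 := by simp [below]

/-- A set containing `V` together with everything just below the box, and closed under passing to
neighbors in `box n a b \ ρ`, contains `box n a b \ ρ` as soon as `ρ` is closed under passing to
neighbors in `box n a b \ V`: walk straight down until `V` or the bottom is reached. -/
theorem box_diff_subset {n : ℕ} {a b : ℤ} {ρ V Q : Set Site}
    (hρ : ∀ x ∈ ρ, ∀ y ∈ box n a b, y ∉ V → lattice.Adj x y → y ∈ ρ)
    (hV : ∀ v ∈ V, v ∈ Q)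
    (hbot : ∀ v ∈ outerBoundary (box n a b), v 2 < a → v ∈ Q)
    (hQ : ∀ x ∈ Q, ∀ y ∈ box n a b, y ∉ ρ → lattice.Adj x y → y ∈ Q) :
    box n a b \ ρ ⊆ Q := by
  suffices h : ∀ k : ℕ, ∀ v ∈ box n a b, v 2 - a = k → v ∉ ρ → v ∈ Q by
    rintro v ⟨hv, hvρ⟩
    have := (mem_box_iff.1 hv).2.2.1
    exact h (v 2 - a).toNat v hv (by omega) hvρ
  intro k
  induction k with
  | zero =>
    intro v hv hk hvρ
    have hb : below v ∉ box n a b := by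
      rw [mem_box_iff, below_apply_two]; push_cast at hk; omega
    exact hQ _ (hbot _ (mem_outerBoundary_of_adj hv hb (adj_below v))
      (by rw [below_apply_two]; push_cast at hk; omega)) v hv hvρ (adj_below v).symm
  | succ k ih =>
    intro v hv hk hvρ
    by_cases hvV : v ∈ V
    · exact hV v hvV
    have hb : below v ∈ box n a b := by
      rw [mem_box_iff] at *; simp only [below]; push_cast at hk; simp; omega
    have hbρ : below v ∉ ρ := fun h => hvρ (hρ _ h v hv hvV (adj_below v).symm)
    exact hQ _ (ih _ hb (by rw [below_apply_two]; push_cast at hk; omega) hbρ) v hv hvρ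
      (adj_below v).symm

/-! ### Components -/

theorem component_subset {S : Set Site} {v : Site} : component S v ⊆ S := fun _ h => h.2.1

theorem mem_component_self {S : Set Site} {v : Site} (hv : v ∈ S) : v ∈ component S v :=
  ⟨hv, hv, SimpleGraph.Reachable.refl _⟩

theorem mem_component_of_adj {S : Set Site} {v w x : Site} (hw : w ∈ component S v) (hx : x ∈ S)
    (h : lattice.Adj w x) : x ∈ component S v := by
  obtain ⟨hv, hw, hr⟩ := hw
  exact ⟨hv, hx, hr.trans (SimpleGraph.Adj.reachable (by simpa using h))⟩

theorem component_symm {S : Set Site} {v w : Site} (h : w ∈ component S v) :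
    v ∈ component S w := by
  obtain ⟨hv, hw, hr⟩ := h
  exact ⟨hw, hv, hr.symm⟩

theorem component_trans {S : Set Site} {v w x : Site} (h : w ∈ component S v)
    (h' : x ∈ component S w) : x ∈ component S v := by
  obtain ⟨hv, hw, hr⟩ := h
  obtain ⟨hw', hx, hr'⟩ := h'
  exact ⟨hv, hx, hr.trans hr'⟩

theorem component_induction {S : Set Site} {v : Site} {P : Site → Prop} (base : P v)
    (step : ∀ a b, a ∈ component S v → b ∈ component S v → lattice.Adj a b → P a → P b)
    {w : Site} (hw : w ∈ component S v) : P w := by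
  obtain ⟨hv, hw, ⟨p⟩⟩ := hw
  suffices h : ∀ (x y : S) (p : (lattice.induce S).Walk x y), (x : Site) ∈ component S v →
      P x → P y from h _ _ p (mem_component_self hv) base
  intro x y p
  induction p with
  | nil => exact fun _ h => h
  | @cons x y z hxy _ ih =>
    intro hx hPx
    have hadj : lattice.Adj (x : Site) y := by simpa using hxy
    have hy := mem_component_of_adj hx y.2 hadj
    exact ih hy (step _ _ hx hy hadj hPx)

/-! ### The blue cluster and the phase above the interface -/

section Phases

variable {q : ℕ} {hq : 2 ≤ q} {Λ : Set Site} {σ σ' : closedRegion Λ → Fin q}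

theorem blue_ne_red (hq : 2 ≤ q) : blue hq ≠ red hq := by
  simp [blue, red]

theorem flipColor_of_lt {h : ℤ} {v : Site} (hv : v 2 < h) : flipColor hq h v = blue hq := by
  have : (v 2 : ℝ) + 1 ≤ h := by exact_mod_cast hv
  rw [flipColor, if_pos]
  rw [pos]; linarith

theorem flipColor_of_le {h : ℤ} {v : Site} (hv : h ≤ v 2) : flipColor hq h v = red hq := by
  have : (h : ℝ) ≤ v 2 := by exact_mod_cast hv
  rw [flipColor, if_neg]
  rw [pos]; linarith

theorem flipColor_eq_blue_iff {h : ℤ} {v : Site} : flipColor hq h v = blue hq ↔ v 2 < h := by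
  refine ⟨fun hv => ?_, flipColor_of_lt⟩
  by_contra! h'
  rw [flipColor_of_le h'] at hv
  exact blue_ne_red hq hv.symm

theorem blueSites_subset : blueSites hq σ ⊆ closedRegion Λ := fun _ h => h.1

theorem blueCluster_subset_blueSites : blueCluster hq σ ⊆ blueSites hq σ :=
  fun _ ⟨_, _, h⟩ => component_subset h

theorem mem_blueSites_iff (v : closedRegion Λ) : (v : Site) ∈ blueSites hq σ ↔ σ v = blue hq :=
  ⟨fun h => h.2, fun h => ⟨v.2, h⟩⟩

theorem mem_blueCluster_of_adj {w x : Site} (hw : w ∈ blueCluster hq σ)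
    (hx : x ∈ blueSites hq σ) (h : lattice.Adj w x) : x ∈ blueCluster hq σ := by
  obtain ⟨b, hb, hw⟩ := hw
  exact ⟨b, hb, mem_component_of_adj hw hx h⟩

theorem mem_blueCluster_of_mem_outerBoundary {b : Site} (hb : b ∈ outerBoundary Λ)
    (h : b ∈ blueSites hq σ) : b ∈ blueCluster hq σ := ⟨b, hb, mem_component_self h⟩

theorem blueCluster_induction {P : Site → Prop}
    (base : ∀ b ∈ outerBoundary Λ, b ∈ blueSites hq σ → P b)
    (step : ∀ a b, a ∈ blueCluster hq σ → b ∈ blueCluster hq σ → lattice.Adj a b → P a → P b)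
    {w : Site} (hw : w ∈ blueCluster hq σ) : P w := by
  obtain ⟨b, hb, hw⟩ := hw
  exact component_induction (base b hb (component_subset (component_symm hw)))
    (fun a c ha hc => step a c ⟨b, hb, ha⟩ ⟨b, hb, hc⟩) hw

theorem blueCluster_mono (h : blueSites hq σ ⊆ blueSites hq σ') :
    blueCluster hq σ ⊆ blueCluster hq σ' := fun _ hw =>
  blueCluster_induction (P := (· ∈ blueCluster hq σ'))
    (fun _ hb hb' => mem_blueCluster_of_mem_outerBoundary hb (h hb'))
    (fun _ _ _ hb hab ha => mem_blueCluster_of_adj ha (h (blueCluster_subset_blueSites hb)) hab) hw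

/-- The complement of the augmented blue set. -/
def redPhase (hq : 2 ≤ q) (σ : closedRegion Λ → Fin q) : Set Site :=
  closedRegion Λ \ augBlue hq σ

/-- A component missing the boundary lies in `Λ`, so its outer neighbors are in the closed region
and hence in the blue cluster: it is a bubble. A component meeting the boundary has a neighbor
outside the closed region, so it is not. -/
theorem mem_redPhase_iff (hΛ : BoundaryExits Λ) {v : Site} : v ∈ redPhase hq σ ↔
    ∃ b ∈ outerBoundary Λ, b ∈ component (closedRegion Λ \ blueCluster hq σ) v := by
  set S := closedRegion Λ \ blueCluster hq σ
  constructor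
  · rintro ⟨hX, hv⟩
    have hvS : v ∈ S := ⟨hX, fun h => hv (Or.inl h)⟩
    by_contra! hb
    refine hv (Or.inr ⟨hvS, fun y hy => ?_⟩)
    obtain ⟨hy, u, hu, hyu⟩ := hy
    have huX : u ∈ Λ := (component_subset hu).1.resolve_right fun h => hb u h hu
    by_contra hyV
    exact hy (mem_component_of_adj hu ⟨mem_closedRegion_of_adj huX hyu.symm, hyV⟩ hyu.symm)
  · rintro ⟨b, hb, hbv⟩
    have hvS : v ∈ S := component_subset (component_symm hbv)
    refine ⟨hvS.1, ?_⟩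
    rintro (h | ⟨-, h⟩)
    · exact hvS.2 h
    · obtain ⟨x, hx, hxb⟩ := hΛ b hb
      have := h ⟨fun h' => hx (component_subset h').1, b, hbv, hxb⟩
      exact hx (blueSites_subset (blueCluster_subset_blueSites this))

theorem redPhase_subset : redPhase hq σ ⊆ closedRegion Λ \ blueCluster hq σ :=
  fun _ h => ⟨h.1, fun h' => h.2 (Or.inl h')⟩

theorem mem_redPhase_of_component (hΛ : BoundaryExits Λ) {v w : Site} (hv : v ∈ redPhase hq σ)
    (hw : w ∈ component (closedRegion Λ \ blueCluster hq σ) v) : w ∈ redPhase hq σ := by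
  rw [mem_redPhase_iff hΛ] at hv ⊢
  obtain ⟨b, hb, hbv⟩ := hv
  exact ⟨b, hb, component_trans (component_symm hw) hbv⟩

theorem mem_redPhase_of_adj (hΛ : BoundaryExits Λ) {v w : Site} (hv : v ∈ redPhase hq σ)
    (hw : w ∈ closedRegion Λ) (hw' : w ∉ blueCluster hq σ) (h : lattice.Adj v w) :
    w ∈ redPhase hq σ :=
  mem_redPhase_of_component hΛ hv
    (mem_component_of_adj (mem_component_self (redPhase_subset hv)) ⟨hw, hw'⟩ h)

theorem mem_redPhase_of_mem_outerBoundary (hΛ : BoundaryExits Λ) {b : Site}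
    (hb : b ∈ outerBoundary Λ) (h : b ∉ blueCluster hq σ) : b ∈ redPhase hq σ :=
  (mem_redPhase_iff hΛ).2 ⟨b, hb, mem_component_self ⟨Or.inr hb, h⟩⟩

theorem redPhase_induction (hΛ : BoundaryExits Λ) {P : Site → Prop}
    (base : ∀ b ∈ outerBoundary Λ, b ∈ redPhase hq σ → P b)
    (step : ∀ a b, a ∈ redPhase hq σ → b ∈ redPhase hq σ → lattice.Adj a b → P a → P b)
    {w : Site} (hw : w ∈ redPhase hq σ) : P w := by
  obtain ⟨b, hb, hbw⟩ := (mem_redPhase_iff hΛ).1 hw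
  have hR : b ∈ redPhase hq σ := mem_redPhase_of_component hΛ hw hbw
  exact component_induction (base b hb hR) (fun a c ha hc => step a c
    (mem_redPhase_of_component hΛ hR ha) (mem_redPhase_of_component hΛ hR hc))
    (component_symm hbw)

theorem redPhase_anti (hΛ : BoundaryExits Λ) (h : blueCluster hq σ ⊆ blueCluster hq σ') :
    redPhase hq σ' ⊆ redPhase hq σ := fun _ hw =>
  redPhase_induction hΛ (P := (· ∈ redPhase hq σ))
    (fun _ hb hb' => mem_redPhase_of_mem_outerBoundary hΛ hb
      fun h' => (redPhase_subset hb').2 (h h'))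
    (fun _ _ _ hb hab ha => mem_redPhase_of_adj hΛ ha hb.1
      (fun h' => (redPhase_subset hb).2 (h h')) hab) hw

theorem diff_augBlue : Λ \ augBlue hq σ = Λ ∩ redPhase hq σ := by
  ext v
  exact ⟨fun h => ⟨h.1, Or.inl h.1, h.2⟩, fun h => ⟨h.1, h.2.2⟩⟩

/-- A sufficient condition for `ρ` to be the part of the complement of the augmented blue set
inside the region. -/
theorem diff_augBlue_eq {ρ : Set Site} (hρ : ρ ⊆ Λ)
    (hblue : Λ \ ρ ⊆ blueCluster hq σ) (hred : ρ ⊆ redPhase hq σ) :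
    Λ \ augBlue hq σ = ρ := by
  rw [diff_augBlue]
  ext v
  refine ⟨fun h => ?_, fun h => ⟨hρ h, hred h⟩⟩
  by_contra hv
  exact (redPhase_subset h.2).2 (hblue ⟨h.1, hv⟩)

variable {h : ℤ}

theorem mem_blueSites_of_mem_outerBoundary (hσ : σ ∈ admissible hq Λ h) {b : Site}
    (hb : b ∈ outerBoundary Λ) : b ∈ blueSites hq σ ↔ b 2 < h := by
  have := hσ ⟨b, Or.inr hb⟩ hb
  rw [mem_blueSites_iff ⟨b, Or.inr hb⟩, this, flipColor_eq_blue_iff]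

theorem mem_blueCluster_iff_of_mem_outerBoundary (hσ : σ ∈ admissible hq Λ h) {b : Site}
    (hb : b ∈ outerBoundary Λ) : b ∈ blueCluster hq σ ↔ b 2 < h := by
  rw [← mem_blueSites_of_mem_outerBoundary hσ hb]
  exact ⟨fun h => blueCluster_subset_blueSites h, mem_blueCluster_of_mem_outerBoundary hb⟩

theorem le_of_mem_redPhase_of_mem_outerBoundary (hσ : σ ∈ admissible hq Λ h) {b : Site}
    (hb : b ∈ outerBoundary Λ) (hR : b ∈ redPhase hq σ) : h ≤ b 2 := by
  by_contra! h'
  exact (redPhase_subset hR).2 ((mem_blueCluster_iff_of_mem_outerBoundary hσ hb).2 h')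

open Classical in
/-- An event increasing in the blue set is closed under recoloring several sites blue. -/
theorem IncreasingInBlue.mem_of_recolor [Finite Λ] {A : Set (closedRegion Λ → Fin q)}
    (hA : IncreasingInBlue hq Λ h A) (hσ : σ ∈ admissible hq Λ h) (hσA : σ ∈ A)
    (hσ' : ∀ v, σ' v = σ v ∨ ((v : Site) ∈ Λ ∧ σ' v = blue hq)) : σ' ∈ A := by
  have := Fintype.ofFinite (closedRegion Λ)
  let f : Finset (closedRegion Λ) → closedRegion Λ → Fin q := fun s v => if v ∈ s then σ' v else σ v
  suffices H : ∀ s, f s ∈ admissible hq Λ h ∧ f s ∈ A by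
    simpa [f] using (H Finset.univ).2
  intro s
  induction s using Finset.induction_on with
  | empty => simpa [f] using ⟨hσ, hσA⟩
  | insert v s hv ih =>
    rcases hσ' v with hv' | ⟨hv', hb⟩
    · have : f (insert v s) = f s := by
        ext w
        by_cases hw : w = v
        · subst hw; simp [f, hv, hv']
        · simp [f, hw]
      rwa [this]
    · have : f (insert v s) = Function.update (f s) v (blue hq) := by
        ext w
        by_cases hw : w = v
        · subst hw; simp [f, hb]
        · simp [f, hw]
      rw [this]
      refine ⟨fun w hw => ?_, hA _ ih.1 ih.2 v hv'⟩
      rw [Function.update_of_ne]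
      · exact ih.1 w hw
      · rintro rfl
        exact hw.1 hv'

end Phases

/-- Suppose the red phase contains a site at negative height, and walk from it in a horizontal
direction. The boundary is blue at this height, so the walk must stay in the box or cross a
plaquette of the interface below height zero. Staying in a finite box forever is impossible. -/
theorem mem_softFloorEvent_iff {q : ℕ} {hq : 2 ≤ q} {n : ℕ} {h : ℤ} (hh : 0 ≤ h)
    {σ : closedRegion (fullBox n) → Fin q} (hσ : σ ∈ admissible hq (fullBox n) h) :
    σ ∈ softFloorEvent hq (fullBox n) ↔ ∀ v ∈ redPhase hq σ, 0 ≤ v 2 := by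
  constructor
  · intro hs v hv
    by_contra! hv0
    let f : ℕ → Site := fun k => ![v 0 + k, v 1, v 2]
    have hf : ∀ k, f k ∈ redPhase hq σ := by
      intro k
      induction k with
      | zero =>
        have : f 0 = v := by ext i; fin_cases i <;> simp [f]
        rwa [this]
      | succ k ih =>
        have hadj : lattice.Adj (f k) (f (k + 1)) := by
          rw [lattice_adj_iff]; simp [f]; omega
        have hk : f k ∈ fullBox n := by
          refine ih.1.resolve_right fun hb => ?_
          have := le_of_mem_redPhase_of_mem_outerBoundary hσ hb ih
          simp [f] at this
          omega
        by_contra hk'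
        have hX := mem_closedRegion_of_adj hk hadj
        have haug : f (k + 1) ∈ augBlue hq σ := by
          by_contra h'; exact hk' ⟨hX, h'⟩
        -- The lowest corner of the cube of `f (k + 1)` lies on the common face and has height `v 2
        -- < 0`.
        have hp : (fun i => ((f (k + 1) i : ℤ) : ℝ)) ∈ cube (f (k + 1)) ∩ cube (f k) := by
          constructor <;> intro i <;> fin_cases i <;> (simp [f]; try linarith)
        have := hs ⟨_, ⟨_, haug, _, ih, hadj.symm, rfl⟩, hp⟩
        have h0 : (0 : ℝ) ≤ ((v 2 : ℤ) : ℝ) := by simpa [f] using this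
        have h0' : 0 ≤ v 2 := by exact_mod_cast h0
        omega
    have hb : ∀ k, f k ∈ fullBox n := fun k => (hf k).1.resolve_right fun hb => by
      have := le_of_mem_redPhase_of_mem_outerBoundary hσ hb (hf k)
      simp [f] at this
      omega
    have h0 := (mem_box_iff.1 (hb 0)).1
    -- The side length of the box is `n`, so a displacement of `n + 1` cannot stay inside.
    have h1 := (mem_box_iff.1 (hb (n + 1))).1
    simp [f] at h0 h1
    omega
  · rintro hR p ⟨-, ⟨x, -, y, hy, -, rfl⟩, hp⟩
    have h1 : (0 : ℝ) ≤ y 2 := by exact_mod_cast hR y hy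
    exact h1.trans (hp.2 2).1

/-! ### The sites that stay free once the pockets reaching below the floor are revealed -/

section Pockets

variable {q : ℕ} {hq : 2 ≤ q} {n : ℕ} {h : ℤ} {σ σ' : closedRegion (fullBox n) → Fin q}

/-- The components of the complement of the blue cluster that reach negative heights. -/
def pocket (hq : 2 ≤ q) (σ : closedRegion (fullBox n) → Fin q) : Set Site :=
  {v | ∃ x, x 2 < 0 ∧ x ∈ component (closedRegion (fullBox n) \ blueCluster hq σ) v}

/-- The sites above the floor that are neither in a pocket nor next to one. -/
def freeSites (hq : 2 ≤ q) (σ : closedRegion (fullBox n) → Fin q) : Set Site :=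
  {v | v ∈ floorBox n ∧ v ∉ pocket hq σ ∧ ∀ x ∈ pocket hq σ, ¬ lattice.Adj x v}

theorem pocket_subset : pocket hq σ ⊆ closedRegion (fullBox n) \ blueCluster hq σ :=
  fun _ ⟨_, _, hx⟩ => component_subset (component_symm hx)

theorem mem_pocket_of_adj {v w : Site} (hv : v ∈ pocket hq σ) (hw : w ∈ closedRegion (fullBox n))
    (hw' : w ∉ blueCluster hq σ) (hvw : lattice.Adj v w) : w ∈ pocket hq σ := by
  obtain ⟨x, hx, hxv⟩ := hv
  refine ⟨x, hx, component_symm (mem_component_of_adj (component_symm hxv) ⟨hw, hw'⟩ hvw)⟩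

theorem mem_pocket_of_lt {v : Site} (hv : v ∈ closedRegion (fullBox n))
    (hv' : v ∉ blueCluster hq σ) (h0 : v 2 < 0) : v ∈ pocket hq σ :=
  ⟨v, h0, mem_component_self ⟨hv, hv'⟩⟩

theorem freeSites_subset : freeSites hq σ ⊆ floorBox n := fun _ h => h.1

/-- A red-phase component never reaches below the floor, hence is no pocket. It cannot touch one
either, since adjacent sites off the blue cluster share a component. -/
theorem redPhase_subset_freeSites (hs : ∀ v ∈ redPhase hq σ, 0 ≤ v 2) {v : Site}
    (hv : v ∈ floorBox n) (hR : v ∈ redPhase hq σ) : v ∈ freeSites hq σ := by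
  have hΛ : BoundaryExits (fullBox n) := boundaryExits_box n _ _
  have hp : v ∉ pocket hq σ := fun ⟨x, hx, hxv⟩ =>
    (hs x (mem_redPhase_of_component hΛ hR hxv)).not_gt hx
  refine ⟨hv, hp, fun x hx hxv => ?_⟩
  exact hp (mem_pocket_of_adj hx hR.1 (redPhase_subset hR).2 hxv)

/-- This is the Markov property behind the transplant. A non-blue neighbor inside the box is off the
blue cluster and in no pocket, hence above the floor; touching a pocket would put it in that pocket,
so it would be free. -/
theorem blue_or_mem_outerBoundary_of_adj_freeSites {x u : Site}
    (hu : u ∈ freeSites hq σ) (hx : x ∉ freeSites hq σ) (hxu : lattice.Adj x u) :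
    x ∈ blueSites hq σ ∨ x ∈ outerBoundary (fullBox n) := by
  obtain ⟨huΛ, hup, hu⟩ := hu
  have hxX : x ∈ closedRegion (fullBox n) :=
    mem_closedRegion_of_adj (mem_floorBox_iff.1 huΛ).1 hxu.symm
  rcases hxX with hxΛ | hxb
  swap
  · exact Or.inr hxb
  left
  by_contra hb
  have hxV : x ∉ blueCluster hq σ := fun h' => hb (blueCluster_subset_blueSites h')
  have hxp : x ∉ pocket hq σ := fun h' => hu x h' hxu
  have hx0 : 0 ≤ x 2 := by
    by_contra! h0
    exact hxp (mem_pocket_of_lt (Or.inl hxΛ) hxV h0)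
  refine hx ⟨mem_floorBox_iff.2 ⟨hxΛ, hx0⟩, hxp, fun y hy hyx => ?_⟩
  exact hxp (mem_pocket_of_adj hy (Or.inl hxΛ) hxV hyx)


theorem admissible_of_eq_off_freeSites (hσ : σ ∈ admissible hq (fullBox n) h)
    (hσ' : ∀ v : closedRegion (fullBox n), (v : Site) ∉ freeSites hq σ → σ' v = σ v) :
    σ' ∈ admissible hq (fullBox n) h := fun v hv => by
  rw [hσ' v fun h' => hv.1 (mem_floorBox_iff.1 h'.1).1, hσ v hv]

/-- Pocket sites keep their colors. At a first entry of the new blue cluster into a pocket, the site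
just outside was already in the old cluster, so the pocket site would have been there too. -/
theorem disjoint_pocket_of_recolor (hσ : σ ∈ admissible hq (fullBox n) h)
    (hσ' : ∀ v : closedRegion (fullBox n), (v : Site) ∉ freeSites hq σ → σ' v = σ v) {v : Site}
    (hv : v ∈ blueCluster hq σ') : v ∉ pocket hq σ := by
  have hadm := admissible_of_eq_off_freeSites hσ hσ'
  refine blueCluster_induction (P := (· ∉ pocket hq σ)) (fun b hb hb' hp => ?_)
    (fun a b ha hb hab hap hbp => ?_) hv
  · rw [mem_blueSites_of_mem_outerBoundary hadm hb] at hb'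
    exact (pocket_subset hp).2 ((mem_blueCluster_iff_of_mem_outerBoundary hσ hb).2 hb')
  · have haX := blueSites_subset (blueCluster_subset_blueSites ha)
    have haV : a ∈ blueCluster hq σ := by
      by_contra h'
      exact hap (mem_pocket_of_adj hbp haX h' hab.symm)
    have hb' := blueCluster_subset_blueSites hb
    rw [mem_blueSites_iff ⟨b, hb'.1⟩, hσ' _ fun h' => h'.2.1 hbp, ← mem_blueSites_iff] at hb'
    exact (pocket_subset hbp).2 (mem_blueCluster_of_adj haV hb' hab)

/-- Added blue enlarges the blue cluster, so pockets can only shrink; by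
`disjoint_pocket_of_recolor` the cluster never enters them, so they do not shrink. -/
theorem freeSites_eq_of_recolor (hσ : σ ∈ admissible hq (fullBox n) h)
    (hσ' : ∀ v : closedRegion (fullBox n), (v : Site) ∉ freeSites hq σ → σ' v = σ v)
    (hblue : blueSites hq σ ⊆ blueSites hq σ') : freeSites hq σ' = freeSites hq σ := by
  suffices hp : pocket hq σ' = pocket hq σ by simp only [freeSites, hp]
  have hV := blueCluster_mono hblue
  ext v
  constructor
  · rintro ⟨x, hx, hxv⟩
    have hv : v ∈ closedRegion (fullBox n) \ blueCluster hq σ' :=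
      component_subset (component_symm hxv)
    refine ⟨x, hx, component_induction
      (P := (· ∈ component (closedRegion (fullBox n) \ blueCluster hq σ) v))
      (mem_component_self ⟨hv.1, fun h' => hv.2 (hV h')⟩) (fun a b _ hb hab ha => ?_) hxv⟩
    have hb := component_subset hb
    exact mem_component_of_adj ha ⟨hb.1, fun h' => hb.2 (hV h')⟩ hab
  · rintro ⟨x, hx, hxv⟩
    have hmem : ∀ a ∈ component (closedRegion (fullBox n) \ blueCluster hq σ) v,
        a ∈ closedRegion (fullBox n) \ blueCluster hq σ' := fun a ha =>
      ⟨(component_subset ha).1, fun h' => disjoint_pocket_of_recolor hσ hσ' h'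
        ⟨x, hx, component_trans (component_symm ha) hxv⟩⟩
    exact ⟨x, hx, component_induction
      (P := (· ∈ component (closedRegion (fullBox n) \ blueCluster hq σ') v))
      (mem_component_self (hmem v (mem_component_self (component_subset (component_symm hxv)))))
      (fun a b _ hb hab ha => mem_component_of_adj ha (hmem b hb) hab) hxv⟩

end Pockets

/-! ### Comparison of a coloring above the hard floor with one above the soft floor -/

section Comparison

variable {q : ℕ} {hq : 2 ≤ q} {n : ℕ} {h : ℤ}

open Classical in
/-- The admissible coloring that is red on `ρ` and blue on the rest of the region. -/
noncomputable def twoColoring (hq : 2 ≤ q) (Λ : Set Site) (h : ℤ) (ρ : Set Site)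
    (v : closedRegion Λ) : Fin q :=
  if (v : Site) ∈ Λ then if (v : Site) ∈ ρ then red hq else blue hq else flipColor hq h v

theorem twoColoring_mem_admissible {Λ ρ : Set Site} :
    twoColoring hq Λ h ρ ∈ admissible hq Λ h := fun _ hv => if_neg hv.1

theorem mem_blueSites_twoColoring {Λ ρ : Set Site} {v : Site} (hv : v ∈ Λ) :
    v ∈ blueSites hq (twoColoring hq Λ h ρ) ↔ v ∉ ρ := by
  rw [mem_blueSites_iff ⟨v, Or.inl hv⟩, twoColoring, if_pos hv]
  by_cases h' : v ∈ ρ <;> simp [h', (blue_ne_red hq).symm]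

/-- The part of the complement of the augmented blue set of `σ` inside the region is also the one
of the coloring that is red exactly there. -/
theorem diff_augBlue_twoColoring (hh : 0 ≤ h) {σ : closedRegion (fullBox n) → Fin q}
    (hσ : σ ∈ admissible hq (fullBox n) h) :
    fullBox n \ augBlue hq (twoColoring hq (fullBox n) h (fullBox n ∩ redPhase hq σ)) =
      fullBox n ∩ redPhase hq σ := by
  have hΛ : BoundaryExits (fullBox n) := boundaryExits_box n _ _
  set ρ := fullBox n ∩ redPhase hq σ
  set τ := twoColoring hq (fullBox n) h ρ
  have hτa : τ ∈ admissible hq (fullBox n) h := twoColoring_mem_admissible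
  have hVρ : ∀ v ∈ blueCluster hq σ, v ∉ ρ := fun v hv h' => (redPhase_subset h'.2).2 hv
  have hVτ : blueCluster hq σ ⊆ blueCluster hq τ := by
    refine fun v hv => blueCluster_induction (P := (· ∈ blueCluster hq τ)) (fun b hb hb' => ?_)
      (fun a b _ hb hab ha => ?_) hv
    · rw [mem_blueSites_of_mem_outerBoundary hσ hb] at hb'
      exact (mem_blueCluster_iff_of_mem_outerBoundary hτa hb).2 hb'
    · rcases (blueSites_subset (blueCluster_subset_blueSites hb)) with hbΛ | hbΛ
      · exact mem_blueCluster_of_adj ha ((mem_blueSites_twoColoring hbΛ).2 (hVρ b hb)) hab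
      · refine (mem_blueCluster_iff_of_mem_outerBoundary hτa hbΛ).2 ?_
        exact (mem_blueCluster_iff_of_mem_outerBoundary hσ hbΛ).1 hb
  have hρτ : ∀ v ∈ ρ, v ∉ blueCluster hq τ := fun v hv h' =>
    (mem_blueSites_twoColoring hv.1).1 (blueCluster_subset_blueSites h') hv
  refine diff_augBlue_eq inter_subset_left ?_ ?_
  · refine box_diff_subset (V := blueCluster hq σ) (fun x hx y hy hyV hxy => ?_) hVτ
      (fun v hv hv' => ?_) (fun x hx y hy hyρ hxy => ?_)
    · exact ⟨hy, mem_redPhase_of_adj hΛ hx.2 (Or.inl hy) hyV hxy⟩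
    · exact (mem_blueCluster_iff_of_mem_outerBoundary hτa hv).2 (by omega)
    · exact mem_blueCluster_of_adj hx ((mem_blueSites_twoColoring hy).2 hyρ) hxy
  · rintro v ⟨-, hv⟩
    refine redPhase_induction hΛ (P := (· ∈ redPhase hq τ)) (fun b hb hb' => ?_)
      (fun a b _ hb hab ha => ?_) hv
    · refine mem_redPhase_of_mem_outerBoundary hΛ hb fun h' => (redPhase_subset hb').2 ?_
      rwa [mem_blueCluster_iff_of_mem_outerBoundary hσ hb,
        ← mem_blueCluster_iff_of_mem_outerBoundary hτa hb]
    · refine mem_redPhase_of_adj hΛ ha hb.1 (fun h' => ?_) hab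
      rcases hb.1 with hbΛ | hbΛ
      · exact hρτ b ⟨hbΛ, hb⟩ h'
      · refine (redPhase_subset hb).2 ?_
        rwa [mem_blueCluster_iff_of_mem_outerBoundary hσ hbΛ,
          ← mem_blueCluster_iff_of_mem_outerBoundary hτa hbΛ]

/-- The sites above the floor joined to the boundary at heights at least `h`, in the complement of
the blue cluster of `τ`, without passing through the lower part of the boundary. -/
def upperPhase (hq : 2 ≤ q) (h : ℤ) (τ : closedRegion (floorBox n) → Fin q) : Set Site :=
  {v | v ∈ floorBox n ∧ ∃ b ∈ outerBoundary (floorBox n), b ∈ component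
    ((closedRegion (floorBox n) \ blueCluster hq τ) \ {v ∈ outerBoundary (floorBox n) | v 2 < h}) v}

variable {τ : closedRegion (floorBox n) → Fin q}

theorem upperPhase_subset : upperPhase hq h τ ⊆ floorBox n := fun _ hv => hv.1

theorem not_mem_blueCluster_of_mem_upperPhase {v : Site} (hv : v ∈ upperPhase hq h τ) :
    v ∉ blueCluster hq τ := by
  obtain ⟨-, b, -, hb⟩ := hv
  exact (component_subset (component_symm hb)).1.2

theorem mem_upperPhase_of_adj {x y : Site} (hx : x ∈ upperPhase hq h τ) (hy : y ∈ floorBox n)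
    (hyV : y ∉ blueCluster hq τ) (hxy : lattice.Adj x y) : y ∈ upperPhase hq h τ := by
  obtain ⟨-, b, hb, hbx⟩ := hx
  refine ⟨hy, b, hb, component_symm (mem_component_of_adj (component_symm hbx) ?_ hxy)⟩
  exact ⟨⟨Or.inl hy, hyV⟩, fun h' => h'.1.1 hy⟩

/-- If every boundary site at height at least `h` and every site of `upperPhase` avoids the blue
cluster of `σ`, then `upperPhase` lies in the complement of the augmented blue set of `σ`. -/
theorem upperPhase_subset_redPhase {Λ : Set Site} (hΛ : BoundaryExits Λ)
    {σ : closedRegion Λ → Fin q} (hΛ' : floorBox n ⊆ Λ)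
    (hb : ∀ b ∈ outerBoundary (floorBox n), h ≤ b 2 → b ∈ outerBoundary Λ ∧ b ∉ blueCluster hq σ)
    (hV : ∀ v ∈ upperPhase hq h τ, v ∉ blueCluster hq σ) :
    upperPhase hq h τ ⊆ redPhase hq σ := by
  rintro v ⟨-, b, hbΛ, hbv⟩
  have hmem : ∀ b ∈ outerBoundary (floorBox n), b ∈ ((closedRegion (floorBox n) \
      blueCluster hq τ) \ {v ∈ outerBoundary (floorBox n) | v 2 < h}) → b ∈ redPhase hq σ := by
    intro b hbΛ hbY
    have hbh : h ≤ b 2 := by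
      by_contra! h'
      exact hbY.2 ⟨hbΛ, h'⟩
    exact mem_redPhase_of_mem_outerBoundary hΛ (hb b hbΛ hbh).1 (hb b hbΛ hbh).2
  refine component_induction (P := (· ∈ redPhase hq σ)) (hmem b hbΛ (component_subset hbv))
    (fun x y hx hy hxy hxR => ?_) (component_symm hbv)
  rcases (component_subset hy).1.1 with hyΛ | hyΛ
  · exact mem_redPhase_of_adj hΛ hxR (Or.inl (hΛ' hyΛ))
      (hV y ⟨hyΛ, b, hbΛ, component_symm hy⟩) hxy
  · exact hmem y hyΛ (component_subset hy)

theorem outerBoundary_floorBox_of_le (hh : 0 ≤ h) {b : Site}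
    (hb : b ∈ outerBoundary (floorBox n)) (hbh : h ≤ b 2) : b ∈ outerBoundary (fullBox n) :=
  (mem_outerBoundary_floorBox_iff (hh.trans hbh)).1 hb

/-- Above the hard floor, `upperPhase` is realized by recoloring blue all sites outside it. -/
theorem upperPhase_mem_of_mem {𝒜 : Set (Set Site)} (hh : 0 ≤ h)
    (incr : IncreasingInBlue hq (floorBox n) 0 (complEvent hq (floorBox n) 𝒜))
    (hτ : τ ∈ admissible hq (floorBox n) 0) (hτA : τ ∈ complEvent hq (floorBox n) 𝒜) :
    upperPhase hq h τ ∈ 𝒜 := by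
  classical
  have hΛ : BoundaryExits (floorBox n) := boundaryExits_box n _ _
  set ρ := upperPhase hq h τ
  let τ' : closedRegion (floorBox n) → Fin q := fun v =>
    if (v : Site) ∈ floorBox n ∧ (v : Site) ∉ ρ then blue hq else τ v
  have hτ'A : τ' ∈ complEvent hq (floorBox n) 𝒜 := by
    refine incr.mem_of_recolor hτ hτA fun v => ?_
    by_cases hv : (v : Site) ∈ floorBox n ∧ (v : Site) ∉ ρ
    · exact Or.inr ⟨hv.1, if_pos hv⟩
    · exact Or.inl (if_neg hv)
  have hτ'a : τ' ∈ admissible hq (floorBox n) 0 := fun v hv => by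
    rw [← hτ v hv]
    exact if_neg fun h' => hv.1 h'.1
  have hsites : blueSites hq τ ⊆ blueSites hq τ' := by
    rintro v ⟨hv, hb⟩
    refine ⟨hv, ?_⟩
    simp only [τ', hb, ite_self]
  have hnew : ∀ v ∈ floorBox n, v ∉ ρ → v ∈ blueSites hq τ' := fun v hv hvρ =>
    ⟨Or.inl hv, if_pos ⟨hv, hvρ⟩⟩
  have hVρ : ∀ v ∈ blueCluster hq τ', v ∉ ρ := fun v hv => by
    refine blueCluster_induction (P := (· ∉ ρ)) (fun b hb _ hbρ => hb.1 hbρ.1)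
      (fun a b ha hb hab haρ hbρ => ?_) hv
    have hbτ : b ∈ blueSites hq τ := by
      obtain ⟨hbX, hb'⟩ := blueCluster_subset_blueSites hb
      rw [mem_blueSites_iff ⟨b, hbX⟩, ← hb']
      exact (if_neg fun h' => h'.2 hbρ).symm
    have haV : a ∈ blueCluster hq τ := by
      rcases blueSites_subset (blueCluster_subset_blueSites ha) with haΛ | haΛ
      · by_contra h'
        exact haρ (mem_upperPhase_of_adj hbρ haΛ h' hab.symm)
      · rwa [mem_blueCluster_iff_of_mem_outerBoundary hτ haΛ,
          ← mem_blueCluster_iff_of_mem_outerBoundary hτ'a haΛ]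
    exact not_mem_blueCluster_of_mem_upperPhase hbρ (mem_blueCluster_of_adj haV hbτ hab)
  have key : floorBox n \ augBlue hq τ' = ρ := by
    refine diff_augBlue_eq upperPhase_subset ?_ ?_
    -- Downward walks attach every site off `ρ` to the blue boundary, so the recolored configuration
    -- has no detached blue islands off `ρ`.
    · refine box_diff_subset (V := blueCluster hq τ) (fun x hx y hy hyV hxy => ?_)
        (blueCluster_mono hsites) (fun v hv hv' => ?_) (fun x hx y hy hyρ hxy => ?_)
      · exact mem_upperPhase_of_adj hx hy hyV hxy
      · exact (mem_blueCluster_iff_of_mem_outerBoundary hτ'a hv).2 hv'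
      · exact mem_blueCluster_of_adj hx (hnew y hy hyρ) hxy
    · refine upperPhase_subset_redPhase hΛ Subset.rfl (fun b hb hbh => ⟨hb, fun h' => ?_⟩)
        fun v hv h' => hVρ v h' hv
      have := (mem_blueCluster_iff_of_mem_outerBoundary hτ'a hb).1 h'
      omega
  rw [← key]
  exact hτ'A

/-- All sites of the full box below height zero are blue and joined to the bottom, so they replace
the blue floor. The blue cluster of `τ` is therefore contained in that of the new coloring, and
downward walks reach the remaining sites off `upperPhase`. -/
theorem diff_augBlue_twoColoring_upperPhase (hh : 0 ≤ h)
    (hτ : τ ∈ admissible hq (floorBox n) 0) :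
    fullBox n \ augBlue hq (twoColoring hq (fullBox n) h (upperPhase hq h τ)) =
      upperPhase hq h τ := by
  have hΛ : BoundaryExits (fullBox n) := boundaryExits_box n _ _
  have hsub : floorBox n ⊆ fullBox n := fun v hv => (mem_floorBox_iff.1 hv).1
  set ρ := upperPhase hq h τ
  set σ := twoColoring hq (fullBox n) h ρ
  have hσa : σ ∈ admissible hq (fullBox n) h := twoColoring_mem_admissible
  have hσV : ∀ v ∈ ρ, v ∉ blueCluster hq σ := fun v hv h' =>
    (mem_blueSites_twoColoring (hsub hv.1)).1 (blueCluster_subset_blueSites h') hv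
  have hstep : ∀ x ∈ blueCluster hq σ, ∀ y ∈ fullBox n, y ∉ ρ → lattice.Adj x y →
      y ∈ blueCluster hq σ := fun x hx y hy hyρ hxy =>
    mem_blueCluster_of_adj hx ((mem_blueSites_twoColoring hy).2 hyρ) hxy
  have hlow : ∀ v ∈ fullBox n, v 2 < 0 → v ∈ blueCluster hq σ := by
    intro v hv hv0
    have hmem : ∀ y ∈ box n (-n) 0, y ∈ fullBox n ∧ y ∉ ρ := fun y hy => by
      refine ⟨?_, fun h' => ?_⟩
      · rw [fullBox, mem_box_iff]; rw [mem_box_iff] at hy; omega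
      · have := (mem_floorBox_iff.1 h'.1).2
        rw [mem_box_iff] at hy; omega
    have := box_diff_subset (n := n) (a := -n) (b := 0) (ρ := ∅) (V := ∅)
      (Q := blueCluster hq σ) (by simp) (by simp) (fun b hb hb' => ?_)
      (fun x hx y hy _ hxy => hstep x hx y (hmem y hy).1 (hmem y hy).2 hxy)
    · refine this ⟨?_, fun h' => h'⟩
      rw [fullBox, mem_box_iff] at hv
      rw [mem_box_iff]; omega
    · obtain ⟨hb1, u, hu, hbu⟩ := hb
      have hbΛ : b ∈ outerBoundary (fullBox n) := by
        refine ⟨fun h' => ?_, u, (hmem u hu).1, hbu⟩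
        rw [fullBox, mem_box_iff] at h'
        omega
      exact (mem_blueCluster_iff_of_mem_outerBoundary hσa hbΛ).2 (by omega)
  have hVV : ∀ v ∈ blueCluster hq τ, v ∈ blueCluster hq σ := by
    have hbot : ∀ b ∈ outerBoundary (floorBox n), b ∈ blueCluster hq τ → b ∈ blueCluster hq σ := by
      intro b hb hb'
      rw [mem_blueCluster_iff_of_mem_outerBoundary hτ hb] at hb'
      exact hlow b (mem_fullBox_of_mem_outerBoundary_floorBox hb hb') hb'
    refine fun v hv => blueCluster_induction (P := (· ∈ blueCluster hq σ)) (fun b hb hb' =>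
      hbot b hb (mem_blueCluster_of_mem_outerBoundary hb hb')) (fun a b _ hb hab ha => ?_) hv
    rcases blueSites_subset (blueCluster_subset_blueSites hb) with hbΛ | hbΛ
    · exact hstep a ha b (hsub hbΛ) (fun h' => not_mem_blueCluster_of_mem_upperPhase h' hb) hab
    · exact hbot b hbΛ hb
  have hup : floorBox n \ ρ ⊆ blueCluster hq σ := by
    refine box_diff_subset (V := blueCluster hq τ) (fun x hx y hy hyV hxy => ?_) hVV
      (fun v hv hv' => ?_) (fun x hx y hy hyρ hxy => hstep x hx y (hsub hy) hyρ hxy)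
    · exact mem_upperPhase_of_adj hx hy hyV hxy
    · exact hVV v ((mem_blueCluster_iff_of_mem_outerBoundary hτ hv).2 hv')
  refine diff_augBlue_eq (fun v hv => hsub hv.1) ?_ ?_
  · rintro v ⟨hv, hvρ⟩
    rcases lt_or_ge (v 2) 0 with h0 | h0
    · exact hlow v hv h0
    · exact hup ⟨mem_floorBox_iff.2 ⟨hv, h0⟩, hvρ⟩
  · refine upperPhase_subset_redPhase hΛ hsub (fun b hb hbh => ?_) hσV
    have hb' := outerBoundary_floorBox_of_le hh hb hbh
    refine ⟨hb', fun h' => ?_⟩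
    exact absurd ((mem_blueCluster_iff_of_mem_outerBoundary hσa hb').1 h') (by omega)

/-- By `hcov`, the blue cluster of `τ` cannot enter the red phase of `σ`: the entry site would be
blue in `σ` and adjacent to the blue cluster of `σ`. So the red phase in the box lies in
`upperPhase`, which belongs to `𝒜`, and monotonicity in the full box passes to the smaller set. -/
theorem mem_complEvent_of_hard {𝒜 : Set (Set Site)} (hh : 0 ≤ h)
    (hard_incr : IncreasingInBlue hq (floorBox n) 0 (complEvent hq (floorBox n) 𝒜))
    (soft_incr : IncreasingInBlue hq (fullBox n) h (complEvent hq (fullBox n) 𝒜))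
    (hτ : τ ∈ admissible hq (floorBox n) 0) (hτA : τ ∈ complEvent hq (floorBox n) 𝒜)
    {σ : closedRegion (fullBox n) → Fin q} (hσ : σ ∈ admissible hq (fullBox n) h)
    (hs : ∀ v ∈ redPhase hq σ, 0 ≤ v 2)
    (hcov : ∀ v ∈ floorBox n, v ∈ blueSites hq τ → v ∈ redPhase hq σ → v ∈ blueSites hq σ) :
    σ ∈ complEvent hq (fullBox n) 𝒜 := by
  have hΛ : BoundaryExits (fullBox n) := boundaryExits_box n _ _
  have hVR : ∀ v ∈ blueCluster hq τ, v ∉ redPhase hq σ := fun v hv => by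
    refine blueCluster_induction (P := (· ∉ redPhase hq σ)) (fun b hb hb' hR => ?_)
      (fun a b ha hb hab haR hbR => ?_) hv
    · have := (mem_blueSites_of_mem_outerBoundary hτ hb).1 hb'
      exact (hs b hR).not_gt this
    · have hbs := blueCluster_subset_blueSites hb
      have hbΛ : b ∈ floorBox n := (blueSites_subset hbs).resolve_right fun h' =>
        (hs b hbR).not_gt ((mem_blueSites_of_mem_outerBoundary hτ h').1 hbs)
      have haX := closedRegion_floorBox_subset (blueSites_subset (blueCluster_subset_blueSites ha))
      have haV : a ∈ blueCluster hq σ := by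
        by_contra h'
        exact haR (mem_redPhase_of_adj hΛ hbR haX h' hab.symm)
      exact (redPhase_subset hbR).2 (mem_blueCluster_of_adj haV (hcov b hbΛ hbs hbR) hab)
  have hRY : redPhase hq σ ⊆ (closedRegion (floorBox n) \ blueCluster hq τ) \
      {v ∈ outerBoundary (floorBox n) | v 2 < h} := fun v hv => by
    have h0 := hs v hv
    refine ⟨⟨mem_closedRegion_floorBox h0 hv.1, fun h' => hVR v h' hv⟩, fun h' => ?_⟩
    exact (le_of_mem_redPhase_of_mem_outerBoundary hσ
      ((mem_outerBoundary_floorBox_iff h0).1 h'.1) hv).not_gt h'.2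
  have hsub : fullBox n ∩ redPhase hq σ ⊆ upperPhase hq h τ := by
    rintro v ⟨hvΛ, hv⟩
    refine ⟨mem_floorBox_iff.2 ⟨hvΛ, hs v hv⟩, ?_⟩
    refine redPhase_induction hΛ (P := fun v => ∃ b ∈ outerBoundary (floorBox n), b ∈ component
      ((closedRegion (floorBox n) \ blueCluster hq τ) \
        {v ∈ outerBoundary (floorBox n) | v 2 < h}) v) (fun b hb hbR => ?_)
      (fun x y hx hy hxy ⟨b, hb, hbx⟩ => ?_) hv
    · exact ⟨b, (mem_outerBoundary_floorBox_iff (hs b hbR)).2 hb, mem_component_self (hRY hbR)⟩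
    · exact ⟨b, hb, component_symm (mem_component_of_adj (component_symm hbx) (hRY hy) hxy)⟩
  have h1 : twoColoring hq (fullBox n) h (upperPhase hq h τ) ∈ complEvent hq (fullBox n) 𝒜 := by
    change _ \ _ ∈ 𝒜
    rw [diff_augBlue_twoColoring_upperPhase hh hτ]
    exact upperPhase_mem_of_mem hh hard_incr hτ hτA
  have h2 : twoColoring hq (fullBox n) h (fullBox n ∩ redPhase hq σ) ∈
      complEvent hq (fullBox n) 𝒜 := by
    -- Shrinking the red set from `upperPhase` to the red phase of `σ` only turns red sites blue.
    refine soft_incr.mem_of_recolor twoColoring_mem_admissible h1 fun v => ?_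
    by_cases hv : (v : Site) ∈ fullBox n
    · by_cases hvρ : (v : Site) ∈ fullBox n ∩ redPhase hq σ
      · left
        simp only [twoColoring, hv, hvρ, hsub hvρ, if_true]
      · right
        refine ⟨hv, ?_⟩
        simp only [twoColoring, hv, hvρ, if_true, if_false]
    · left
      simp only [twoColoring, hv, if_false]
  change _ \ _ ∈ 𝒜 at h2
  rw [diff_augBlue_twoColoring hh hσ, ← diff_augBlue] at h2
  exact h2

/-- The soft-floor event is compatible with the boundary values. -/
theorem exists_mem_softFloorEvent (hh : 0 ≤ h) :
    ∃ σ ∈ admissible hq (fullBox n) h, σ ∈ softFloorEvent hq (fullBox n) := by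
  refine ⟨twoColoring hq (fullBox n) h ∅, twoColoring_mem_admissible, ?_⟩
  have hσa : twoColoring hq (fullBox n) h ∅ ∈ admissible hq (fullBox n) h :=
    twoColoring_mem_admissible
  rw [mem_softFloorEvent_iff hh hσa]
  intro v hv
  rcases hv.1 with hvΛ | hvΛ
  · refine absurd (?_ : v ∈ blueCluster hq (twoColoring hq (fullBox n) h ∅)) (redPhase_subset hv).2
    refine box_diff_subset (ρ := ∅) (V := ∅) (by simp) (by simp) (fun b hb hb' => ?_)
      (fun x hx y hy _ hxy => ?_) ⟨hvΛ, fun h' => h'⟩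
    · exact (mem_blueCluster_iff_of_mem_outerBoundary hσa hb).2 (by omega)
    · exact mem_blueCluster_of_adj hx ((mem_blueSites_twoColoring hy).2 fun h' => h') hxy
  · exact hh.trans (le_of_mem_redPhase_of_mem_outerBoundary hσa hvΛ hv)

end Comparison
/-! ### Locality of the number of disagreements -/

section Locality

variable {q : ℕ}

/-- Extension of a coloring of the closed region by blue. -/
noncomputable def extendBlue (hq : 2 ≤ q) {Λ : Set Site} (σ : closedRegion Λ → Fin q) (v : Site) :
    Fin q :=
  open Classical in if hv : v ∈ closedRegion Λ then σ ⟨v, hv⟩ else blue hq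

theorem extendBlue_apply (hq : 2 ≤ q) {Λ : Set Site} (σ : closedRegion Λ → Fin q) {v : Site}
    (hv : v ∈ closedRegion Λ) : extendBlue hq σ v = σ ⟨v, hv⟩ := dif_pos hv

/-- Every lattice edge meeting `U ⊆ Λ` lies in the region graph. The first term thus involves only
lattice edges at `U`, and can be compared between different regions. -/
theorem disagreements_eq (hq : 2 ≤ q) {Λ U : Set Site} [Finite Λ] (hU : U ⊆ Λ)
    (σ : closedRegion Λ → Fin q) :
    disagreements (regionGraph Λ) σ =
      {e ∈ lattice.edgeSet | (∃ v ∈ e, v ∈ U) ∧ ¬ (e.map (extendBlue hq σ)).IsDiag}.ncard +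
      {e ∈ lattice.edgeSet | (∀ v ∈ e, v ∈ closedRegion Λ ∧ v ∉ U) ∧
        ¬ (e.map (extendBlue hq σ)).IsDiag}.ncard := by
  have himage : Sym2.map Subtype.val '' {e ∈ (regionGraph Λ).edgeSet | ¬ (e.map σ).IsDiag} =
      {e ∈ lattice.edgeSet | (∃ v ∈ e, v ∈ U) ∧ ¬ (e.map (extendBlue hq σ)).IsDiag} ∪
      {e ∈ lattice.edgeSet | (∀ v ∈ e, v ∈ closedRegion Λ ∧ v ∉ U) ∧
        ¬ (e.map (extendBlue hq σ)).IsDiag} := by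
    ext e
    constructor
    · rintro ⟨e, ⟨he, hd⟩, rfl⟩
      induction e with | _ a b
      have he : lattice.Adj a b := by simpa [regionGraph] using he
      have hd : ¬ σ a = σ b := by simpa using hd
      by_cases hab : (a : Site) ∈ U ∨ (b : Site) ∈ U
      · left
        refine ⟨by simpa using he, by simpa using hab, ?_⟩
        simpa [extendBlue_apply] using hd
      · right
        push Not at hab
        refine ⟨by simpa using he, by simp [hab], ?_⟩
        simpa [extendBlue_apply] using hd
    · have aux : ∀ e ∈ lattice.edgeSet, (∀ v ∈ e, v ∈ closedRegion Λ) →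
          ¬ (e.map (extendBlue hq σ)).IsDiag →
          e ∈ Sym2.map Subtype.val '' {e ∈ (regionGraph Λ).edgeSet | ¬ (e.map σ).IsDiag} := by
        intro e he hX hd
        induction e with | _ a b
        have ha := hX a (by simp)
        have hb := hX b (by simp)
        refine ⟨s(⟨a, ha⟩, ⟨b, hb⟩), ⟨?_, ?_⟩, by simp⟩
        · simpa [regionGraph] using he
        · simpa [extendBlue_apply hq σ ha, extendBlue_apply hq σ hb] using hd
      rintro (⟨he, ⟨v, hv, hvU⟩, hd⟩ | ⟨he, hX, hd⟩)
      · refine aux e he (fun w hw => ?_) hd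
        by_cases hvw : w = v
        · exact Or.inl (hU (hvw ▸ hvU))
        · have : e = s(v, w) := ((Sym2.mem_and_mem_iff (Ne.symm hvw)).1 ⟨hv, hw⟩)
          subst this
          exact mem_closedRegion_of_adj (hU hvU) (by simpa using he)
      · exact aux e he (fun v hv => (hX v hv).1) hd
  have hfin := (Set.toFinite {e ∈ (regionGraph Λ).edgeSet | ¬ (e.map σ).IsDiag}).image
    (Sym2.map Subtype.val)
  rw [disagreements, ← Set.ncard_image_of_injective _ (Sym2.map.injective Subtype.val_injective),
    himage]
  rw [himage] at hfin
  refine Set.ncard_union_eq ?_ (hfin.subset subset_union_left) (hfin.subset subset_union_right)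
  rw [Set.disjoint_left]
  rintro e ⟨-, ⟨v, hv, hvU⟩, -⟩ ⟨-, h', -⟩
  exact (h' v hv).2 hvU

theorem map_isDiag_congr {s t : Site → Fin q} {e : Sym2 Site} (h : ∀ v ∈ e, s v = t v) :
    (e.map s).IsDiag ↔ (e.map t).IsDiag := by
  induction e with | _ a b
  simp [h a (by simp), h b (by simp)]

/-- The change in the number of disagreements when recoloring `U` only depends on the colors in
`U` and next to it. -/
theorem disagreements_add_eq {Λ Λ' U : Set Site} [Finite Λ] [Finite Λ'] (hq : 2 ≤ q)
    (hU : U ⊆ Λ) (hU' : U ⊆ Λ') {σ σ' : closedRegion Λ → Fin q} {τ τ' : closedRegion Λ' → Fin q}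
    (hσ : ∀ v : closedRegion Λ, (v : Site) ∉ U → σ v = σ' v)
    (hτ : ∀ v : closedRegion Λ', (v : Site) ∉ U → τ v = τ' v)
    (hin : ∀ v (hv : v ∈ U), σ ⟨v, Or.inl (hU hv)⟩ = τ ⟨v, Or.inl (hU' hv)⟩)
    (hin' : ∀ v (hv : v ∈ U), σ' ⟨v, Or.inl (hU hv)⟩ = τ' ⟨v, Or.inl (hU' hv)⟩)
    (hout : ∀ x (hx : x ∈ closedRegion Λ) (hx' : x ∈ closedRegion Λ'), x ∉ U →
      (∃ u ∈ U, lattice.Adj x u) → σ ⟨x, hx⟩ = τ ⟨x, hx'⟩) :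
    disagreements (regionGraph Λ) σ + disagreements (regionGraph Λ') τ' =
      disagreements (regionGraph Λ) σ' + disagreements (regionGraph Λ') τ := by
  rw [disagreements_eq hq hU, disagreements_eq hq hU, disagreements_eq hq hU',
    disagreements_eq hq hU']
  have hfar : ∀ {Λ : Set Site} {σ σ' : closedRegion Λ → Fin q},
      (∀ v : closedRegion Λ, (v : Site) ∉ U → σ v = σ' v) →
      {e ∈ lattice.edgeSet | (∀ v ∈ e, v ∈ closedRegion Λ ∧ v ∉ U) ∧
        ¬ (e.map (extendBlue hq σ)).IsDiag} =
      {e ∈ lattice.edgeSet | (∀ v ∈ e, v ∈ closedRegion Λ ∧ v ∉ U) ∧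
        ¬ (e.map (extendBlue hq σ')).IsDiag} := by
    intro Λ σ σ' h
    ext e
    refine and_congr_right fun _ => and_congr_right fun he => not_congr
      (map_isDiag_congr fun v hv => ?_)
    rw [extendBlue_apply hq _ (he v hv).1, extendBlue_apply hq _ (he v hv).1]
    exact h ⟨v, (he v hv).1⟩ (he v hv).2
  have hnear : ∀ {σ : closedRegion Λ → Fin q} {τ : closedRegion Λ' → Fin q},
      (∀ v (hv : v ∈ U), σ ⟨v, Or.inl (hU hv)⟩ = τ ⟨v, Or.inl (hU' hv)⟩) →
      (∀ x (hx : x ∈ closedRegion Λ) (hx' : x ∈ closedRegion Λ'), x ∉ U →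
        (∃ u ∈ U, lattice.Adj x u) → σ ⟨x, hx⟩ = τ ⟨x, hx'⟩) →
      {e ∈ lattice.edgeSet | (∃ v ∈ e, v ∈ U) ∧ ¬ (e.map (extendBlue hq σ)).IsDiag} =
      {e ∈ lattice.edgeSet | (∃ v ∈ e, v ∈ U) ∧ ¬ (e.map (extendBlue hq τ)).IsDiag} := by
    intro σ τ hin hout
    ext e
    refine and_congr_right fun he => and_congr_right fun ⟨u, hu, huU⟩ => not_congr
      (map_isDiag_congr fun v hv => ?_)
    by_cases hvU : v ∈ U
    · rw [extendBlue_apply hq _ (Or.inl (hU hvU)), extendBlue_apply hq _ (Or.inl (hU' hvU))]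
      exact hin v hvU
    · have huv : u ≠ v := fun h => hvU (h ▸ huU)
      have : e = s(u, v) := (Sym2.mem_and_mem_iff huv).1 ⟨hu, hv⟩
      subst this
      have hadj : lattice.Adj u v := by simpa using he
      have h1 := mem_closedRegion_of_adj (hU huU) hadj
      have h2 := mem_closedRegion_of_adj (hU' huU) hadj
      rw [extendBlue_apply hq _ h1, extendBlue_apply hq _ h2]
      exact hout v h1 h2 hvU ⟨u, huU, hadj.symm⟩
  rw [hfar hσ, hfar hτ, hnear hin hout, hnear (σ := σ') (τ := τ') hin' ?_]
  · ring
  · intro x hx hx' hxU hxu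
    rw [← hσ ⟨x, hx⟩ hxU, ← hτ ⟨x, hx'⟩ hxU]
    exact hout x hx hx' hxU hxu

end Locality

/-! ### The comparison on each class of soft-floor colorings -/

section Fibers

open Classical

variable {q : ℕ} {hq : 2 ≤ q} {n : ℕ} {h : ℤ} {β : ℝ}

/-- The Gibbs weight of a coloring. -/
noncomputable def gibbsWeight (β : ℝ) (Λ : Set Site) (σ : closedRegion Λ → Fin q) : ℝ :=
  Real.exp (-β * disagreements (regionGraph Λ) σ)

/-- The coloring above the hard floor that agrees with `σ` on `U`, is blue on the rest of the box
and has boundary values flipping at height `h`. -/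
noncomputable def transplant (hq : 2 ≤ q) (h : ℤ) (U : Set Site)
    (σ : closedRegion (fullBox n) → Fin q) (v : closedRegion (floorBox n)) : Fin q :=
  if (v : Site) ∈ U then σ ⟨v, closedRegion_floorBox_subset v.2⟩
  else if (v : Site) ∈ floorBox n then blue hq else flipColor hq h v

/-- The ratio of the two weights is constant under recoloring of the free sites, because their
outside neighbors have the same colors in both boxes. At negative heights this uses `0 ≤ h`: the
boundary of the floor box is blue there. -/
theorem gibbsWeight_transplant (hh : 0 ≤ h) {σ₀ σ : closedRegion (fullBox n) → Fin q}
    (hσ₀ : σ₀ ∈ admissible hq (fullBox n) h)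
    (hσ : ∀ v : closedRegion (fullBox n), (v : Site) ∉ freeSites hq σ₀ → σ v = σ₀ v) :
    gibbsWeight β (fullBox n) σ * gibbsWeight β (floorBox n) (transplant hq h (freeSites hq σ₀) σ₀) =
      gibbsWeight β (fullBox n) σ₀ *
        gibbsWeight β (floorBox n) (transplant hq h (freeSites hq σ₀) σ) := by
  set U := freeSites hq σ₀
  have hU : U ⊆ floorBox n := freeSites_subset
  have key := disagreements_add_eq (Λ := fullBox n) (Λ' := floorBox n) (U := U) hq
    (fun v hv => (mem_floorBox_iff.1 (hU hv)).1) hU (σ := σ) (σ' := σ₀)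
    (τ := transplant hq h U σ) (τ' := transplant hq h U σ₀) hσ
    (fun v hv => by simp only [transplant, hv, if_false])
    (fun v hv => by simp only [transplant, hv, if_true])
    (fun v hv => by simp only [transplant, hv, if_true]) ?_
  · simp only [gibbsWeight, ← Real.exp_add]
    congr 1
    rw [← mul_add, ← mul_add]
    congr 1
    exact_mod_cast key
  · rintro x hx hx' hxU ⟨u, hu, hxu⟩
    rw [hσ _ hxU]
    simp only [transplant, hxU, if_false]
    rcases blue_or_mem_outerBoundary_of_adj_freeSites hu hxU hxu with hb | hb
    · rw [mem_blueSites_iff ⟨x, hx⟩] at hb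
      rw [hb]
      split_ifs with hxΛ
      · rfl
      · rcases hx with hx | hx
        · have : x 2 < 0 := by
            by_contra! h0
            exact hxΛ (mem_floorBox_iff.2 ⟨hx, h0⟩)
          rw [flipColor_of_lt (by omega)]
        · rw [← hb, hσ₀ _ hx]
    · rw [if_neg fun h' => hb.1 (mem_floorBox_iff.1 h').1, hσ₀ _ hb]

variable [Fintype (closedRegion (floorBox n))]

/-- The boundary sites that are red above the hard floor. -/
def redBoundary (n : ℕ) : Set (closedRegion (floorBox n)) :=
  {v | (v : Site) ∉ floorBox n ∧ 0 ≤ (v : Site) 2}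

theorem fuzzyWeight_eq_sum_admissible {X : Set (closedRegion (floorBox n))}
    (hX : ∀ v : closedRegion (floorBox n), (v : Site) ∉ floorBox n →
      (v ∈ X ↔ 0 ≤ (v : Site) 2)) :
    fuzzyWeight hq (regionGraph (floorBox n)) β (redBoundary n) X =
      ∑ τ with τ ∈ admissible hq (floorBox n) 0 ∧ {v | τ v ≠ blue hq} = X,
        gibbsWeight β (floorBox n) τ := by
  rw [fuzzyWeight]
  refine Finset.sum_congr (Finset.ext fun τ => ?_) fun _ _ => rfl
  simp only [Finset.mem_filter, Finset.mem_univ, true_and]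
  rw [and_comm]
  refine and_congr_left fun hτ => ⟨fun h v hv => ?_, fun h v hv => ?_⟩
  · by_cases h0 : 0 ≤ (v : Site) 2
    · rw [flipColor_of_le h0]
      exact h v ⟨(hX v hv.1).2 h0, hv.1, h0⟩
    · rw [flipColor_of_lt (by omega)]
      have : v ∉ {v | τ v ≠ blue hq} := by rw [hτ, hX v hv.1]; exact h0
      simpa using this
  · rw [h v (v.2.resolve_left hv.2.1), flipColor_of_le hv.2.2]

variable [Fintype (closedRegion (fullBox n))]

/-- Transplanting is a bijection onto the colorings counted by `fuzzyWeight`, and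
`gibbsWeight_transplant` makes it weight-preserving up to the two constants. Boundary sites at
heights in `[0, h)` belong to `redBoundary` but are blue here. -/
theorem mul_fuzzyWeight_eq_sum_transplant (hh : 0 ≤ h) {σ₀ : closedRegion (fullBox n) → Fin q}
    (hσ₀ : σ₀ ∈ admissible hq (fullBox n) h) {Y : Set (closedRegion (floorBox n))}
    (hY : ∀ v : closedRegion (floorBox n), (v : Site) ∉ freeSites hq σ₀ →
      (v ∈ Y ↔ (v : Site) ∉ floorBox n ∧ h ≤ (v : Site) 2)) :
    gibbsWeight β (fullBox n) σ₀ *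
        fuzzyWeight hq (regionGraph (floorBox n)) β (redBoundary n) Y =
      gibbsWeight β (floorBox n) (transplant hq h (freeSites hq σ₀) σ₀) *
      ∑ σ with (∀ v : closedRegion (fullBox n), (v : Site) ∉ freeSites hq σ₀ → σ v = σ₀ v) ∧
        {v | transplant hq h (freeSites hq σ₀) σ v ≠ blue hq} = Y,
        gibbsWeight β (fullBox n) σ := by
  set U := freeSites hq σ₀
  have hUsub : ∀ {v}, v ∈ U → v ∈ floorBox n := fun hv => freeSites_subset hv
  rw [fuzzyWeight, Finset.mul_sum, Finset.mul_sum]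
  symm
  refine Finset.sum_nbij' (transplant hq h U)
    (fun τ v => if hv : (v : Site) ∈ U then τ ⟨v, Or.inl (hUsub hv)⟩ else σ₀ v) ?_ ?_ ?_ ?_ ?_
  · intro σ hσ
    simp only [Finset.mem_filter, Finset.mem_univ, true_and] at hσ ⊢
    refine ⟨hσ.2, fun v hv => ?_⟩
    have hvU : (v : Site) ∉ U := fun h' => hv.2.1 (hUsub h')
    have := (hY v hvU).1 hv.1
    simp only [transplant, hvU, hv.2.1, if_false]
    exact flipColor_of_le this.2
  · intro τ hτ
    simp only [Finset.mem_filter, Finset.mem_univ, true_and] at hτ ⊢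
    refine ⟨fun v hv => dif_neg hv, ?_⟩
    rw [← hτ.1]
    ext v
    by_cases hvU : (v : Site) ∈ U
    · simp [transplant, hvU]
    · have h1 := hY v hvU
      rw [← hτ.1] at h1
      refine Iff.trans ?_ h1.symm
      by_cases hvΛ : (v : Site) ∈ floorBox n
      · simp [transplant, hvU, hvΛ]
      · simp [transplant, hvU, hvΛ, flipColor_eq_blue_iff]
  · intro σ hσ
    simp only [Finset.mem_filter, Finset.mem_univ, true_and] at hσ
    ext v
    by_cases hvU : (v : Site) ∈ U
    · simp [transplant, hvU]
    · simp [hvU, hσ.1 v hvU]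
  · intro τ hτ
    simp only [Finset.mem_filter, Finset.mem_univ, true_and] at hτ
    ext v
    by_cases hvU : (v : Site) ∈ U
    · simp [transplant, hvU]
    · have h1 := hY v hvU
      rw [← hτ.1] at h1
      by_cases hvΛ : (v : Site) ∈ floorBox n
      · have : τ v = blue hq := by simpa [hvΛ] using h1
        simp [transplant, hvU, hvΛ, this]
      · rcases lt_or_ge ((v : Site) 2) h with hlt | hle
        · have : τ v = blue hq := by simpa [hvΛ, hlt.not_ge] using h1
          simp [transplant, hvU, hvΛ, this, flipColor_of_lt hlt]
        · have hvY : v ∈ Y := (hY v hvU).2 ⟨hvΛ, hle⟩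
          have : τ v = red hq := hτ.2 v ⟨hvY, hvΛ, hh.trans hle⟩
          simp [transplant, hvU, hvΛ, this, flipColor_of_le hle]
  · intro σ hσ
    simp only [Finset.mem_filter, Finset.mem_univ, true_and] at hσ
    rw [mul_comm, gibbsWeight_transplant hh hσ₀ hσ.1]
    rfl

/-- The soft-floor colorings that share the free sites of `σ₀` and its colors elsewhere. -/
def softClass (hq : 2 ≤ q) (h : ℤ) (σ₀ : closedRegion (fullBox n) → Fin q) :
    Set (closedRegion (fullBox n) → Fin q) :=
  {σ | σ ∈ admissible hq (fullBox n) h ∧ σ ∈ softFloorEvent hq (fullBox n) ∧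
    freeSites hq σ = freeSites hq σ₀ ∧
    ∀ v : closedRegion (fullBox n), (v : Site) ∉ freeSites hq σ₀ → σ v = σ₀ v}

theorem softClass_comparison (hβ : 0 ≤ β) (hh : 0 ≤ h) {𝒜 : Set (Set Site)}
    (hard_incr : IncreasingInBlue hq (floorBox n) 0 (complEvent hq (floorBox n) 𝒜))
    (soft_incr : IncreasingInBlue hq (fullBox n) h (complEvent hq (fullBox n) 𝒜))
    {σ₀ : closedRegion (fullBox n) → Fin q} (hσ₀ : σ₀ ∈ admissible hq (fullBox n) h) :
    (∑ τ with τ ∈ admissible hq (floorBox n) 0 ∧ τ ∈ complEvent hq (floorBox n) 𝒜,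
        gibbsWeight β (floorBox n) τ) *
      ∑ σ with σ ∈ softClass hq h σ₀, gibbsWeight β (fullBox n) σ ≤
    (∑ σ with σ ∈ softClass hq h σ₀ ∧ σ ∈ complEvent hq (fullBox n) 𝒜,
        gibbsWeight β (fullBox n) σ) *
      ∑ τ with τ ∈ admissible hq (floorBox n) 0, gibbsWeight β (floorBox n) τ := by
  set U := freeSites hq σ₀
  have hg : ∀ {Λ : Set Site} (σ : closedRegion Λ → Fin q), 0 ≤ gibbsWeight β Λ σ :=
    fun σ => (Real.exp_pos _).le
  let nb : (closedRegion (floorBox n) → Fin q) → Set (closedRegion (floorBox n)) :=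
    fun τ => {v | τ v ≠ blue hq}
  have four := four_functions_theorem_univ
    (fun X => ∑ τ with (τ ∈ admissible hq (floorBox n) 0 ∧ τ ∈ complEvent hq (floorBox n) 𝒜) ∧
      nb τ = X, gibbsWeight β (floorBox n) τ)
    (fun X => ∑ σ with σ ∈ softClass hq h σ₀ ∧ nb (transplant hq h U σ) = X,
      gibbsWeight β (fullBox n) σ)
    (fun X => ∑ σ with (σ ∈ softClass hq h σ₀ ∧ σ ∈ complEvent hq (fullBox n) 𝒜) ∧
      nb (transplant hq h U σ) = X, gibbsWeight β (fullBox n) σ)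
    (fun X => ∑ τ with τ ∈ admissible hq (floorBox n) 0 ∧ nb τ = X, gibbsWeight β (floorBox n) τ)
    (fun X => Finset.sum_nonneg fun _ _ => hg _) (fun X => Finset.sum_nonneg fun _ _ => hg _)
    (fun X => Finset.sum_nonneg fun _ _ => hg _) (fun X => Finset.sum_nonneg fun _ _ => hg _) ?_
  -- Summing over all possible non-blue sets recovers the four total weights.
  · simp only [← Finset.filter_filter, Finset.sum_fiberwise] at four ⊢
    exact four
  intro X Y
  have hnn := mul_nonneg
    (Finset.sum_nonneg fun σ (_ : σ ∈ Finset.univ.filter fun σ => (σ ∈ softClass hq h σ₀ ∧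
      σ ∈ complEvent hq (fullBox n) 𝒜) ∧ nb (transplant hq h U σ) = X ⊓ Y) => hg σ)
    (Finset.sum_nonneg fun τ (_ : τ ∈ Finset.univ.filter fun τ =>
      τ ∈ admissible hq (floorBox n) 0 ∧ nb τ = X ⊔ Y) => hg τ)
  -- If `X` or `Y` is not attained, the left side vanishes; otherwise representatives `τ₁` and `σ₂`
  -- fix the boundary pattern of `X` and `Y`.
  by_cases hX : ∃ τ, (τ ∈ admissible hq (floorBox n) 0 ∧ τ ∈ complEvent hq (floorBox n) 𝒜) ∧
      nb τ = X
  swap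
  · refine le_of_eq_of_le ?_ hnn
    rw [Finset.filter_false_of_mem fun τ _ hτ => hX ⟨τ, hτ⟩, Finset.sum_empty, zero_mul]
  by_cases hY : ∃ σ, σ ∈ softClass hq h σ₀ ∧ nb (transplant hq h U σ) = Y
  swap
  · refine le_of_eq_of_le ?_ hnn
    rw [Finset.filter_false_of_mem fun σ _ hσ => hY ⟨σ, hσ⟩, Finset.sum_empty, mul_zero]
  obtain ⟨τ₁, ⟨hτ₁, hτ₁A⟩, hτX⟩ := hX
  obtain ⟨σ₂, ⟨hσ₂, hσ₂s, hσ₂U, hσ₂eq⟩, hσY⟩ := hY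
  have hXb : ∀ v : closedRegion (floorBox n), (v : Site) ∉ floorBox n →
      (v ∈ X ↔ 0 ≤ (v : Site) 2) := by
    intro v hv
    rw [← hτX]
    change τ₁ v ≠ blue hq ↔ _
    rw [hτ₁ v (v.2.resolve_left hv), Ne, flipColor_eq_blue_iff, not_lt]
  have hYb : ∀ v : closedRegion (floorBox n), (v : Site) ∉ U →
      (v ∈ Y ↔ (v : Site) ∉ floorBox n ∧ h ≤ (v : Site) 2) := by
    intro v hv
    rw [← hσY]
    change transplant hq h U σ₂ v ≠ blue hq ↔ _
    by_cases hvΛ : (v : Site) ∈ floorBox n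
    · simp [transplant, hv, hvΛ]
    · simp [transplant, hv, hvΛ, flipColor_eq_blue_iff]
  have hUΛ : ∀ v, v ∉ floorBox n → v ∉ U := fun v hv hvU => hv (freeSites_subset hvU)
  have hinf : ∀ v : closedRegion (floorBox n), (v : Site) ∉ U →
      (v ∈ X ∩ Y ↔ (v : Site) ∉ floorBox n ∧ h ≤ (v : Site) 2) := by
    intro v hv
    rw [mem_inter_iff, hYb v hv]
    exact ⟨fun h' => h'.2, fun h' => ⟨(hXb v h'.1).2 (hh.trans h'.2), h'⟩⟩
  have hsup : ∀ v : closedRegion (floorBox n), (v : Site) ∉ floorBox n →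
      (v ∈ X ∪ Y ↔ 0 ≤ (v : Site) 2) := by
    intro v hv
    rw [mem_union, hYb v (hUΛ v hv), hXb v hv]
    exact ⟨fun h' => h'.elim id fun h' => hh.trans h'.2, Or.inl⟩
  have h1 : (∑ τ with (τ ∈ admissible hq (floorBox n) 0 ∧ τ ∈ complEvent hq (floorBox n) 𝒜) ∧
      nb τ = X, gibbsWeight β (floorBox n) τ) ≤
      fuzzyWeight hq (regionGraph (floorBox n)) β (redBoundary n) X := by
    rw [fuzzyWeight_eq_sum_admissible hXb]
    exact Finset.sum_le_sum_of_subset_of_nonneg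
      (Finset.monotone_filter_right _ fun τ _ hτ => ⟨hτ.1.1, hτ.2⟩) fun _ _ _ => hg _
  have h2 : (∑ σ with σ ∈ softClass hq h σ₀ ∧ nb (transplant hq h U σ) = Y,
      gibbsWeight β (fullBox n) σ) ≤
      ∑ σ with (∀ v : closedRegion (fullBox n), (v : Site) ∉ freeSites hq σ₀ → σ v = σ₀ v) ∧
        nb (transplant hq h U σ) = Y, gibbsWeight β (fullBox n) σ :=
    Finset.sum_le_sum_of_subset_of_nonneg
      (Finset.monotone_filter_right _ fun σ _ hσ => ⟨hσ.1.2.2.2, hσ.2⟩) fun _ _ _ => hg _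
  -- A coloring with non-blue set `X ∩ Y` is bluer than `σ₂`, hence stays in the class. Its red
  -- phase in the floor box consists of free sites, where it is blue wherever `τ₁` is; this is the
  -- covering condition of `mem_complEvent_of_hard`.
  have h3 : (∑ σ with (∀ v : closedRegion (fullBox n), (v : Site) ∉ freeSites hq σ₀ →
        σ v = σ₀ v) ∧ nb (transplant hq h U σ) = X ∩ Y, gibbsWeight β (fullBox n) σ) ≤
      ∑ σ with (σ ∈ softClass hq h σ₀ ∧ σ ∈ complEvent hq (fullBox n) 𝒜) ∧
        nb (transplant hq h U σ) = X ∩ Y, gibbsWeight β (fullBox n) σ := by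
    refine Finset.sum_le_sum_of_subset_of_nonneg
      (Finset.monotone_filter_right _ fun σ _ hσ => ⟨?_, hσ.2⟩) fun _ _ _ => hg _
    obtain ⟨hσ, hσXY⟩ := hσ
    have hΛ : BoundaryExits (fullBox n) := boundaryExits_box n _ _
    have hfree : ∀ v (hv : v ∈ U), v ∈ blueSites hq σ ↔
        (⟨v, Or.inl (freeSites_subset hv)⟩ : closedRegion (floorBox n)) ∉ X ∩ Y := by
      intro v hv
      rw [← hσXY, mem_blueSites_iff
        ⟨v, closedRegion_floorBox_subset (Or.inl (freeSites_subset hv))⟩]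
      simp [nb, transplant, hv]
    have hfree₂ : ∀ v (hv : v ∈ U), v ∈ blueSites hq σ₂ ↔
        (⟨v, Or.inl (freeSites_subset hv)⟩ : closedRegion (floorBox n)) ∉ Y := by
      intro v hv
      rw [← hσY, mem_blueSites_iff
        ⟨v, closedRegion_floorBox_subset (Or.inl (freeSites_subset hv))⟩]
      simp [nb, transplant, hv]
    have heq : ∀ v : closedRegion (fullBox n), (v : Site) ∉ freeSites hq σ₂ → σ v = σ₂ v := by
      intro v hv
      rw [hσ₂U] at hv
      rw [hσ v hv, hσ₂eq v hv]
    have hblue : blueSites hq σ₂ ⊆ blueSites hq σ := by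
      intro v hv
      by_cases hvU : v ∈ U
      · exact (hfree v hvU).2 fun h' => (hfree₂ v hvU).1 hv h'.2
      · have hvX := hv.1
        rw [mem_blueSites_iff ⟨v, hvX⟩] at hv ⊢
        rw [heq ⟨v, hvX⟩ (by rwa [hσ₂U]), hv]
    have hadm := admissible_of_eq_off_freeSites hσ₂ heq
    have hUσ : freeSites hq σ = U := (freeSites_eq_of_recolor hσ₂ heq hblue).trans hσ₂U
    have hs : ∀ v ∈ redPhase hq σ, 0 ≤ v 2 := fun v hv =>
      (mem_softFloorEvent_iff hh hσ₂).1 hσ₂s v (redPhase_anti hΛ (blueCluster_mono hblue) hv)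
    refine ⟨⟨hadm, (mem_softFloorEvent_iff hh hadm).2 hs, hUσ, hσ⟩,
      mem_complEvent_of_hard hh hard_incr soft_incr hτ₁ hτ₁A hadm hs fun v hv hvτ hvR => ?_⟩
    have hvU : v ∈ U := hUσ ▸ redPhase_subset_freeSites hs hv hvR
    refine (hfree v hvU).2 fun h' => ?_
    have := h'.1
    rw [← hτX] at this
    exact this hvτ.2
  have h4 : (∑ τ with τ ∈ admissible hq (floorBox n) 0 ∧ nb τ = X ∪ Y,
      gibbsWeight β (floorBox n) τ) =
      fuzzyWeight hq (regionGraph (floorBox n)) β (redBoundary n) (X ∪ Y) :=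
    (fuzzyWeight_eq_sum_admissible hsup).symm
  have hc : 0 < gibbsWeight β (floorBox n) (transplant hq h U σ₀) := Real.exp_pos _
  have eY := mul_fuzzyWeight_eq_sum_transplant (β := β) hh hσ₀ hYb
  have eXY := mul_fuzzyWeight_eq_sum_transplant (β := β) hh hσ₀ hinf
  have hfnn : ∀ Z, 0 ≤ fuzzyWeight hq (regionGraph (floorBox n)) β (redBoundary n) Z :=
    fun Z => Finset.sum_nonneg fun _ _ => (Real.exp_pos _).le
  have hsuper := fuzzyWeight_mul_le hq (regionGraph (floorBox n)) hβ (redBoundary n) X Y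
  refine (mul_le_mul h1 h2 (Finset.sum_nonneg fun _ _ => hg _) (hfnn X)).trans
    (le_trans ?_ (mul_le_mul_of_nonneg_right h3 (Finset.sum_nonneg fun _ _ => hg _)))
  change _ ≤ _ * ∑ τ with τ ∈ admissible hq (floorBox n) 0 ∧ nb τ = X ∪ Y, _
  rw [h4]
  refine le_of_mul_le_mul_left ?_ hc
  rw [mul_left_comm, ← mul_assoc (gibbsWeight β (floorBox n) _), ← eXY, ← eY, mul_left_comm,
    mul_assoc]
  exact mul_le_mul_of_nonneg_left hsuper (hg σ₀)

/-- The comparison of the two unnormalized measures. -/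
theorem weight_comparison (hβ : 0 ≤ β) (hh : 0 ≤ h) {𝒜 : Set (Set Site)}
    (hard_incr : IncreasingInBlue hq (floorBox n) 0 (complEvent hq (floorBox n) 𝒜))
    (soft_incr : IncreasingInBlue hq (fullBox n) h (complEvent hq (fullBox n) 𝒜)) :
    (∑ τ with τ ∈ admissible hq (floorBox n) 0 ∩ complEvent hq (floorBox n) 𝒜,
        gibbsWeight β (floorBox n) τ) *
      ∑ σ with σ ∈ admissible hq (fullBox n) h ∩ softFloorEvent hq (fullBox n),
        gibbsWeight β (fullBox n) σ ≤
    (∑ σ with σ ∈ (admissible hq (fullBox n) h ∩ softFloorEvent hq (fullBox n)) ∩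
        complEvent hq (fullBox n) 𝒜, gibbsWeight β (fullBox n) σ) *
      ∑ τ with τ ∈ admissible hq (floorBox n) 0, gibbsWeight β (floorBox n) τ := by
  let key : (closedRegion (fullBox n) → Fin q) → Set Site × (closedRegion (fullBox n) → Fin q) :=
    fun σ => (freeSites hq σ, fun v => if (v : Site) ∈ freeSites hq σ then blue hq else σ v)
  have hkey : ∀ σ σ₀, key σ = key σ₀ ↔ freeSites hq σ = freeSites hq σ₀ ∧
      ∀ v : closedRegion (fullBox n), (v : Site) ∉ freeSites hq σ₀ → σ v = σ₀ v := by
    intro σ σ₀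
    simp only [key, Prod.mk.injEq]
    refine and_congr_right fun hU => ?_
    rw [hU, funext_iff]
    refine forall_congr' fun v => ?_
    by_cases hv : (v : Site) ∈ freeSites hq σ₀ <;> simp [hv]
  set S := Finset.univ.filter fun σ : closedRegion (fullBox n) → Fin q =>
    σ ∈ admissible hq (fullBox n) h ∩ softFloorEvent hq (fullBox n) with hS
  have hS' : (Finset.univ.filter fun σ : closedRegion (fullBox n) → Fin q =>
      σ ∈ (admissible hq (fullBox n) h ∩ softFloorEvent hq (fullBox n)) ∩
        complEvent hq (fullBox n) 𝒜) = S.filter fun σ => σ ∈ complEvent hq (fullBox n) 𝒜 := by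
    rw [hS, Finset.filter_filter]; rfl
  have hcls : ∀ σ₀, S.filter (fun σ => key σ = key σ₀) =
      Finset.univ.filter fun σ => σ ∈ softClass hq h σ₀ := by
    intro σ₀
    rw [hS, Finset.filter_filter]
    refine Finset.filter_congr fun σ _ => ?_
    rw [hkey, mem_inter_iff, and_assoc]
    rfl
  clear_value S
  rw [hS', ← Finset.sum_fiberwise_of_maps_to (s := S) (t := S.image key) (g := key)
      (fun σ hσ => Finset.mem_image_of_mem key hσ),
    ← Finset.sum_fiberwise_of_maps_to (s := S.filter fun σ => σ ∈ complEvent hq (fullBox n) 𝒜)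
      (t := S.image key) (g := key)
      (fun σ hσ => Finset.mem_image_of_mem key (Finset.mem_filter.1 hσ).1),
    Finset.mul_sum, Finset.sum_mul]
  refine Finset.sum_le_sum fun k hk => ?_
  obtain ⟨σ₀, hσ₀, rfl⟩ := Finset.mem_image.1 hk
  rw [Finset.filter_comm, hcls, Finset.filter_filter]
  rw [hS, Finset.mem_filter] at hσ₀
  exact softClass_comparison hβ hh hard_incr soft_incr hσ₀.2.1

end Fibers

/-! ### From measures to sums -/

section Measures

open Classical

variable {q : ℕ} {β : ℝ} {Λ : Set Site} [Finite Λ] [Fintype (closedRegion Λ)]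

theorem pottsWeight_apply (S : Set (closedRegion Λ → Fin q)) :
    pottsWeight (regionGraph Λ) β q S = ENNReal.ofReal (∑ σ with σ ∈ S, gibbsWeight β Λ σ) := by
  have hS : MeasurableSet S := S.toFinite.measurableSet
  rw [pottsWeight, withDensity_apply _ hS, ← lintegral_indicator hS, lintegral_count,
    tsum_fintype, ENNReal.ofReal_sum_of_nonneg (f := gibbsWeight β Λ) fun _ _ => (Real.exp_pos _).le,
    Finset.sum_filter]
  rfl

/-- The partition function cancels in the conditioning, leaving a ratio of Gibbs sums. -/
theorem pottsMeasure_cond_apply {S : Set (closedRegion Λ → Fin q)} (hS : S.Nonempty)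
    (E : Set (closedRegion Λ → Fin q)) :
    ((pottsMeasure (regionGraph Λ) β q)[|S]) E = ENNReal.ofReal
      ((∑ σ with σ ∈ S ∩ E, gibbsWeight β Λ σ) / ∑ σ with σ ∈ S, gibbsWeight β Λ σ) := by
  have hpos : ∀ {S : Set (closedRegion Λ → Fin q)}, S.Nonempty →
      0 < ∑ σ with σ ∈ S, gibbsWeight β Λ σ := fun ⟨σ, hσ⟩ =>
    Finset.sum_pos (fun _ _ => Real.exp_pos _) ⟨σ, by simpa using hσ⟩
  have hZ : pottsWeight (regionGraph Λ) β q univ ≠ 0 := by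
    rw [pottsWeight_apply]
    exact (ENNReal.ofReal_pos.2 (hpos (hS.mono (subset_univ _)))).ne'
  have hZ' : pottsWeight (regionGraph Λ) β q univ ≠ ⊤ := by
    rw [pottsWeight_apply]; exact ENNReal.ofReal_ne_top
  rw [cond_apply S.toFinite.measurableSet, pottsMeasure, Measure.smul_apply, Measure.smul_apply,
    smul_eq_mul, smul_eq_mul, ENNReal.mul_inv (Or.inl (ENNReal.inv_ne_zero.2 hZ'))
      (Or.inl (ENNReal.inv_ne_top.2 hZ)), inv_inv, mul_mul_mul_comm,
    ENNReal.mul_inv_cancel hZ hZ', one_mul, pottsWeight_apply, pottsWeight_apply,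
    ENNReal.ofReal_div_of_pos (hpos hS), ENNReal.div_eq_inv_mul]
  congr!

instance : IsFiniteMeasure (pottsMeasure (regionGraph Λ) β q) := by
  constructor
  rw [pottsMeasure, Measure.smul_apply, smul_eq_mul]
  rcases eq_or_ne (pottsWeight (regionGraph Λ) β q univ) 0 with h | h
  · simp [h]
  · refine ENNReal.mul_lt_top (ENNReal.inv_lt_top.2 (pos_iff_ne_zero.2 h)) ?_
    rw [pottsWeight_apply]; exact ENNReal.ofReal_lt_top

end Measures

end PottsFloor

theorem proposition2p6 (q : ℕ) (hq : 2 ≤ q) (β : ℝ) (hβ : 0 < β) (n : ℕ) (h : ℤ) (hh : 0 ≤ h)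
    (𝒜 : Set (Set PottsFloor.Site))
    (hard_incr : PottsFloor.IncreasingInBlue hq (PottsFloor.floorBox n) 0
      (PottsFloor.complEvent hq (PottsFloor.floorBox n) 𝒜))
    (soft_incr : PottsFloor.IncreasingInBlue hq (PottsFloor.fullBox n) h
      (PottsFloor.complEvent hq (PottsFloor.fullBox n) 𝒜)) :
    PottsFloor.hardFloorMeasure hq β n (PottsFloor.complEvent hq (PottsFloor.floorBox n) 𝒜) ≤
      PottsFloor.softFloorMeasure hq β n h
        (PottsFloor.complEvent hq (PottsFloor.fullBox n) 𝒜) := by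
  open PottsFloor in
  classical
  have := Fintype.ofFinite (closedRegion (floorBox n))
  have := Fintype.ofFinite (closedRegion (fullBox n))
  have hhard : (admissible hq (floorBox n) 0).Nonempty :=
    ⟨fun v => flipColor hq 0 v, fun _ _ => rfl⟩
  have hsoft : (admissible hq (fullBox n) h ∩ softFloorEvent hq (fullBox n)).Nonempty := by
    obtain ⟨σ, hσ, hσ'⟩ := exists_mem_softFloorEvent (hq := hq) (n := n) hh
    exact ⟨σ, hσ, hσ'⟩
  -- The two successive conditionings of the soft-floor measure merge into one on the intersection,
  -- which is nonempty by `hsoft`.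
  rw [softFloorMeasure, hardFloorMeasure, flipMeasure, flipMeasure,
    cond_cond_eq_cond_inter (Set.toFinite _).measurableSet (Set.toFinite _).measurableSet,
    pottsMeasure_cond_apply hhard, pottsMeasure_cond_apply hsoft]
  refine ENNReal.ofReal_le_ofReal ?_
  rw [div_le_div_iff₀]
  · refine le_trans (le_of_eq ?_) ((weight_comparison hβ.le hh hard_incr soft_incr).trans
      (le_of_eq ?_)) <;> congr!
  · obtain ⟨σ, hσ⟩ := hhard
    exact Finset.sum_pos (fun _ _ => Real.exp_pos _) ⟨σ, by simpa using hσ⟩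
  · obtain ⟨σ, hσ⟩ := hsoft
    exact Finset.sum_pos (fun _ _ => Real.exp_pos _) ⟨σ, by simpa using hσ⟩
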